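/- Let $w\ge 0$ be an integrable weight function on $[-1,1]$ with $\int_{-1}^1 w>0$, let $p_n$ be its orthogonal polynomial of degree $n\ge1$, and let $c_w=(\int_{-1}^1 w)^{-1}$. Put $$\Omega=\{(x+y,\,xy): -1<x<y<1\}=\{(u,v): 1+u+v>0,\ 1-u+v>0,\ u^2>4v,\ |u|<2\}.$$ For $\gamma=\pm\frac12$ let $$W_\gamma(u,v)=b_{w,\gamma}\,w(x)w(y)(u^2-4v)^\gamma\quad (u=x+y,\ v=xy),\qquad \int_\Omega W_\gamma(u,v)\,du\,dv=1,$$ where the last equation defines the constant $b_{w,\gamma}$, and on $[-1,1]^2$ let $$\mathcal W_\gamma(x,y)=W_\gamma(2xy,\,x^2+y^2-1)\,|x^2-y^2|.$$ Let $\Pi_m^2$ be the space of real polynomials of degree at most $m$ in two variables, so $\dim\Pi_m^2=\frac{(m+1)(m+2)}2$. A finite sum $\sum_i c_i f(z_i)$ with distinct nodes $z_i\in\mathbb R^2$ and real weights $c_i\ne0$ is a cubature rule of degree $m$ for $\mathcal W_\gamma$ if it equals $\int_{[-1,1]^2} f\,\mathcal W_\gamma\,dx\,dy$ for all $f\in\Pi^2_m$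 but not for all $f\in\Pi^2_{m+1}$. It is minimal if no rule that is exact on $\Pi^2_m$ has fewer nodes. **Theorem.** The polynomial $p_n$ has $n$ distinct zeros $\cos\theta_k$ with $0<\theta_k<\pi$, $1\le k\le n$. With $l_k$ the fundamental Lagrange polynomials at these zeros and $\lambda_k=c_w\int_{-1}^1 l_k\,w$, the Gauss quadrature formula $c_w\int_{-1}^1 f\,w=\sum_{k=1}^n\lambda_k f(\cos\theta_k)$ holds for all polynomials $f$ of degree at most $2n-1$. Put $$s_{j,k}=\cos\tfrac{\theta_j-\theta_k}2,\qquad t_{j,k}=\cos\tfrac{\theta_j+\theta_k}2,$$ $$F_{j,k}(f)=f(s_{j,k},t_{j,k})+f(t_{j,k},s_{j,k})+f(-s_{j,k},-t_{j,k})+f(-t_{j,k},-s_{j,k}).$$ 1. The rule $$\int_{[-1,1]^2} f\,\mathcal W_{-\frac12}\,dx\,dy=\frac12\sum_{k=1}^n\mathop{{\sum}'}_{j=1}^{k}\lambda_k\lambda_j\,F_{j,k}(f),$$ where $\sum'$ means that the term with $j=k$ is halved, is a minimal cubature rule of degree $4n-1$ and has exactly $\dim\Pi_{2n-1}^2+n$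 nodes. 2. For $n\ge2$, with $\lambda_{j,k}=\lambda_j\lambda_k(\cos\theta_j-\cos\theta_k)^2$ and $\kappa=b_{w,\frac12}/(2c_w^2)$, the rule $$\int_{[-1,1]^2} f\,\mathcal W_{\frac12}\,dx\,dy=\frac{\kappa}{2}\sum_{k=2}^n\sum_{j=1}^{k-1}\lambda_{j,k}\,F_{j,k}(f)$$ is a minimal cubature rule of degree $4n-5$ and has exactly $\dim\Pi_{2n-3}^2+n-1$ nodes. These node numbers are Möller's lower bound $\dim\Pi_{m-1}^2+\lfloor m/2\rfloor$ for cubature rules of degree $2m-1$ and centrally symmetric weight functions, with $m=2n$ and $m=2n-2$, respectively. -/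

import Mathlib

open MeasureTheory Set Polynomial

noncomputable section

namespace MinimalCubature

/-! One variable: a weight `w` on `[-1,1]`, its orthogonal polynomials and Gauss weights. -/

/-- The pairing `∫_{-1}^1 p(t) q(t) w(t) dt`. -/
def wInner (w : ℝ → ℝ) (p q : ℝ[X]) : ℝ :=
  ∫ t in Icc (-1 : ℝ) 1, p.eval t * q.eval t * w t

/-- The monic orthogonal polynomial `p_n` of degree `n` with respect to `w` on `[-1,1]`,
by the Gram-Schmidt process applied to `1, X, X^2, …`. -/
def orthoPoly (w : ℝ → ℝ) : ℕ → ℝ[X]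
  | n => X ^ n - ∑ k : Fin n,
      C (wInner w (X ^ n) (orthoPoly w k) / wInner w (orthoPoly w k) (orthoPoly w k)) *
        orthoPoly w k
  termination_by n => n
  decreasing_by all_goals exact k.2

/-- `c_w`, the constant with `c_w ∫_{-1}^1 w = 1`. -/
def cNorm (w : ℝ → ℝ) : ℝ := (∫ t in Icc (-1 : ℝ) 1, w t)⁻¹

/-- `θ` lists the angles in `(0, π)` of the zeros `x_k = cos θ_k` of `p_n`, each zero once. -/
def IsZeroAngles (w : ℝ → ℝ) (n : ℕ) (θ : Fin n → ℝ) : Prop :=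
  Function.Injective θ ∧ ∀ k, θ k ∈ Ioo 0 Real.pi ∧ (orthoPoly w n).IsRoot (Real.cos (θ k))

/-- The quadrature weight `λ_k = c_w ∫_{-1}^1 l_k(t) w(t) dt`, where `l_k` is the fundamental
Lagrange polynomial at the points `x_j = cos θ_j`. -/
def gaussWeight (w : ℝ → ℝ) {n : ℕ} (θ : Fin n → ℝ) (k : Fin n) : ℝ :=
  cNorm w * ∫ t in Icc (-1 : ℝ) 1,
    (Lagrange.basis Finset.univ (fun j => Real.cos (θ j)) k).eval t * w t

/-! The weight functions in two variables. -/

/-- The domain bounded by the lines `1 + u + v = 0`, `1 - u + v = 0` and the parabola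
`u² = 4v`. The condition `|u| < 2` selects the bounded component; equivalently, the domain
is the set of all `(x + y, x y)` with `-1 < x < y < 1`. -/
def Omega : Set (ℝ × ℝ) :=
  {z | 0 < 1 + z.1 + z.2 ∧ 0 < 1 - z.1 + z.2 ∧ 4 * z.2 < z.1 ^ 2 ∧ |z.1| < 2}

/-- `w(x) w(y) (u² - 4v)^γ` with `u = x + y`, `v = x y`, that is, with `x`, `y` the two
roots of `X² - u X + v`. -/
def preWeight (w : ℝ → ℝ) (γ : ℝ) (z : ℝ × ℝ) : ℝ :=
  w ((z.1 + √(z.1 ^ 2 - 4 * z.2)) / 2) * w ((z.1 - √(z.1 ^ 2 - 4 * z.2)) / 2) *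
    (z.1 ^ 2 - 4 * z.2) ^ γ

/-- `b_{w,γ}`, the constant that makes the integral of `W_γ` over the domain equal to one. -/
def bNorm (w : ℝ → ℝ) (γ : ℝ) : ℝ := (∫ z in Omega, preWeight w γ z)⁻¹

/-- `W_γ(u,v) = b_{w,γ} w(x) w(y) (u² - 4v)^γ`. -/
def weightW (w : ℝ → ℝ) (γ : ℝ) (z : ℝ × ℝ) : ℝ := bNorm w γ * preWeight w γ z

/-- `𝒲_γ(x,y) = W_γ(2xy, x² + y² - 1) |x² - y²|`. -/
def weightCW (w : ℝ → ℝ) (γ : ℝ) (z : ℝ × ℝ) : ℝ :=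
  weightW w γ (2 * z.1 * z.2, z.1 ^ 2 + z.2 ^ 2 - 1) * |z.1 ^ 2 - z.2 ^ 2|

/-- The square `[-1,1]²`. -/
def square : Set (ℝ × ℝ) := Icc (-1) 1 ×ˢ Icc (-1) 1

/-! Cubature rules. -/

/-- The value of a polynomial in two variables at a point of the plane. -/
def evalAt (f : MvPolynomial (Fin 2) ℝ) (z : ℝ × ℝ) : ℝ := MvPolynomial.eval ![z.1, z.2] f

/-- `dim Π_m²`, the dimension of the space of polynomials of degree at most `m` in two
variables. -/
def dimPi (m : ℕ) : ℕ := Module.finrank ℝ (MvPolynomial.restrictTotalDegree (Fin 2) ℝ m)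

/-- A cubature rule `f ↦ ∑ c_i f(z_i)`, stored as the finitely supported function that assigns to
each point of the plane its weight. Its nodes are the points of nonzero weight. -/
abbrev Rule := (ℝ × ℝ) →₀ ℝ

/-- The value `∑ c_i f(z_i)` of the rule on `f`. -/
def Rule.apply (Q : Rule) (f : ℝ × ℝ → ℝ) : ℝ := Q.sum fun z c => c * f z

/-- The number of nodes. -/
def Rule.numNodes (Q : Rule) : ℕ := Q.support.card

/-- `Q` integrates all polynomials of degree at most `m` exactly with respect to `W` on `D`. -/
def IsExact (D : Set (ℝ × ℝ)) (W : ℝ × ℝ → ℝ) (m : ℕ) (Q : Rule) : Prop :=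
  ∀ f : MvPolynomial (Fin 2) ℝ, f.totalDegree ≤ m →
    IntegrableOn (fun z => evalAt f z * W z) D ∧
      ∫ z in D, evalAt f z * W z = Q.apply (evalAt f)

/-- `Q` is a cubature rule of degree (precision) `m`: it is exact in degree at most `m`, and
fails for some polynomial of degree at most `m + 1`. -/
def HasDegree (D : Set (ℝ × ℝ)) (W : ℝ × ℝ → ℝ) (m : ℕ) (Q : Rule) : Prop :=
  IsExact D W m Q ∧
    ∃ f : MvPolynomial (Fin 2) ℝ, f.totalDegree ≤ m + 1 ∧
      IntegrableOn (fun z => evalAt f z * W z) D ∧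
        ∫ z in D, evalAt f z * W z ≠ Q.apply (evalAt f)

/-- `Q` is a minimal cubature rule of degree `m`: it has degree `m`, and no rule (with real weights
and nodes anywhere in the plane) that is exact in degree at most `m` has fewer nodes. -/
def IsMinimalRule (D : Set (ℝ × ℝ)) (W : ℝ × ℝ → ℝ) (m : ℕ) (Q : Rule) : Prop :=
  HasDegree D W m Q ∧ ∀ Q' : Rule, IsExact D W m Q' → Q.numNodes ≤ Q'.numNodes

/-! The explicit rules. -/

/-- `f ↦ f(s,t) + f(t,s) + f(-s,-t) + f(-t,-s)`. -/
def fourPoints (s t : ℝ) : Rule :=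
  Finsupp.single (s, t) 1 + Finsupp.single (t, s) 1 +
    Finsupp.single (-s, -t) 1 + Finsupp.single (-t, -s) 1

/-- `s_{j,k} = cos ((θ_j - θ_k) / 2)`. -/
def sNode {n : ℕ} (θ : Fin n → ℝ) (j k : Fin n) : ℝ := Real.cos ((θ j - θ k) / 2)

/-- `t_{j,k} = cos ((θ_j + θ_k) / 2)`. -/
def tNode {n : ℕ} (θ : Fin n → ℝ) (j k : Fin n) : ℝ := Real.cos ((θ j + θ k) / 2)

/-- The rule `½ ∑_k ∑'_{j ≤ k} λ_k λ_j [f(s,t) + f(t,s) + f(-s,-t) + f(-t,-s)]` with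
`s = s_{j,k}`, `t = t_{j,k}`, where the terms with `j = k` are halved. -/
def ruleMinus (w : ℝ → ℝ) {n : ℕ} (θ : Fin n → ℝ) : Rule :=
  (1 / 2 : ℝ) • ∑ k : Fin n, ∑ j ∈ Finset.Iic k,
    ((if j = k then (1 / 2 : ℝ) else 1) * (gaussWeight w θ k * gaussWeight w θ j)) •
      fourPoints (sNode θ j k) (tNode θ j k)

/-- `λ_{j,k} = λ_j λ_k (cos θ_j - cos θ_k)²`. -/
def lambdaPair (w : ℝ → ℝ) {n : ℕ} (θ : Fin n → ℝ) (j k : Fin n) : ℝ :=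
  gaussWeight w θ j * gaussWeight w θ k * (Real.cos (θ j) - Real.cos (θ k)) ^ 2

/-- The rule `κ ½ ∑_k ∑_{j < k} λ_{j,k} [f(s,t) + f(t,s) + f(-s,-t) + f(-t,-s)]` with
`s = s_{j,k}`, `t = t_{j,k}` and `κ = b_{w,1/2} / (2 c_w²)`, the ratio of the constant that
normalizes the weight function for `γ = 1/2` to the one for `γ = -1/2`. -/
def rulePlus (w : ℝ → ℝ) {n : ℕ} (θ : Fin n → ℝ) : Rule :=
  (bNorm w (1 / 2) / (2 * cNorm w ^ 2)) • (1 / 2 : ℝ) •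
    ∑ k : Fin n, ∑ j ∈ Finset.Iio k,
      lambdaPair w θ j k • fourPoints (sNode θ j k) (tNode θ j k)

end MinimalCubature

end

/-!
The integral for `𝒲_γ`, `γ = e - 1/2` with `e = 0, 1`, reduces to the product weight `w(x) w(y)`.
The weight is invariant under the four maps `(s, t) ↦ ±(s, t), ±(t, s)`, and `foldMap`, that is
`(s, t) ↦ (2 s t, s² + t² - 1)`, maps the sector `|s| < t < 1`, which is a quarter of the square,
bijectively onto `Ω`. The map `symMap`, `(x, y) ↦ (x + y, x y)`, maps the triangle
`-1 < x < y < 1` bijectively onto `Ω` as well. Changing variables twice turns `∫ F 𝒲_γ` into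
`∫∫ G(x + y, x y) w(x) w(y) (x - y)^{2e}` up to a constant, where `G` is the sum of `F` over the
four maps (`setIntegral_square_mul_weightCW`). For a monomial `F` of degree `2d` this `G` has degree
at most `d` in `x` and in `y` (`exists_symmetrization`), and for odd degree it vanishes. Hence the
product of two Gauss rules, pulled back to the square, is exact up to degree `4(n - e) - 1`; since
`x = cos θ_j`, `y = cos θ_k` corresponds to `s = s_{j,k}`, `t = t_{j,k}` (`foldMap_nodes`), these
are the explicit rules. They fail one degree higher, for `(s² + t² - 1)^{2n - 2e}`, since the Gauss rule
underestimates `∫ x^{2n} w` (`productRule_ne`).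

The zeros of `p_n` are real, simple and in `(-1, 1)` because a factor of `p_n` without change of
sign there would contradict orthogonality (`not_dvd_orthoPoly_of_nonneg`).

Minimality is Möller's bound (`two_mul_le_numNodes`). For a rule that is exact in degree `4k - 1`,
evaluation at the nodes embeds the odd polynomials of degree at most `2k - 1`, a space of dimension
`k (k + 1)`, into the functions on the nodes. With a linear form `ℓ` that vanishes at no node
besides the origin, multiplication by `ℓ` and by the cubature weights maps the image injectively to a space
orthogonal to it, because the rule annihilates odd polynomials. So there are at least `2 k (k + 1)`
nodes. The explicit rules have at most that many nodes, with `k = n - e`; the bound itself then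
shows that their nodes are distinct and their weights nonzero.
-/

open MeasureTheory Set Polynomial

noncomputable section

namespace MinimalCubature

/-! ### Gauss quadrature for the weight -/

section OneVariable

variable {w : ℝ → ℝ}

lemma integrableOn_mul_weight (hw_int : IntegrableOn w (Icc (-1 : ℝ) 1)) {f : ℝ → ℝ}
    (hf : Continuous f) : IntegrableOn (fun t => f t * w t) (Icc (-1 : ℝ) 1) :=
  hw_int.continuousOn_mul hf.continuousOn isCompact_Icc

lemma integrableOn_eval_mul_weight (hw_int : IntegrableOn w (Icc (-1 : ℝ) 1)) (p : ℝ[X]) :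
    IntegrableOn (fun t => p.eval t * w t) (Icc (-1 : ℝ) 1) :=
  integrableOn_mul_weight hw_int p.continuous

/-- A nonzero polynomial vanishes only on a finite set, whereas the weight is positive on a set
of positive measure. -/
lemma integral_eval_mul_weight_pos (hw_nonneg : ∀ t ∈ Icc (-1 : ℝ) 1, 0 ≤ w t)
    (hw_int : IntegrableOn w (Icc (-1 : ℝ) 1)) (hw_pos : 0 < ∫ t in Icc (-1 : ℝ) 1, w t)
    {p : ℝ[X]} (hp : p ≠ 0) (hp_nonneg : ∀ t ∈ Icc (-1 : ℝ) 1, 0 ≤ p.eval t) :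
    0 < ∫ t in Icc (-1 : ℝ) 1, p.eval t * w t := by
  have h0 : 0 ≤ᵐ[volume.restrict (Icc (-1 : ℝ) 1)] fun t => p.eval t * w t :=
    (ae_restrict_iff' measurableSet_Icc).2
      (.of_forall fun t ht => mul_nonneg (hp_nonneg t ht) (hw_nonneg t ht))
  refine (integral_nonneg_of_ae h0).lt_of_ne fun h => hw_pos.ne' ?_
  have h1 := (integral_eq_zero_iff_of_nonneg_ae h0 (integrableOn_eval_mul_weight hw_int p)).1 h.symm
  have hfin : ∀ᵐ t ∂(volume : Measure ℝ), p.eval t ≠ 0 := by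
    have : {t | ¬ p.eval t ≠ 0}.Finite := by
      refine (p.roots.toFinset.finite_toSet).subset fun t ht => ?_
      simpa [hp] using ht
    exact this.measure_zero _
  have h2 : w =ᵐ[volume.restrict (Icc (-1 : ℝ) 1)] 0 := by
    filter_upwards [h1, ae_restrict_of_ae hfin] with t ht ht'
    simpa [ht'] using ht
  rw [integral_congr_ae h2]
  simp

lemma wInner_add_left (hw_int : IntegrableOn w (Icc (-1 : ℝ) 1)) (p q r : ℝ[X]) :
    wInner w (p + q) r = wInner w p r + wInner w q r := by
  unfold wInner
  rw [← integral_add]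
  · simp only [eval_add, add_mul]
  · simpa [IntegrableOn] using integrableOn_eval_mul_weight hw_int (p * r)
  · simpa [IntegrableOn] using integrableOn_eval_mul_weight hw_int (q * r)

lemma wInner_C_mul_left (c : ℝ) (p q : ℝ[X]) : wInner w (C c * p) q = c * wInner w p q := by
  unfold wInner
  rw [← integral_const_mul]
  simp only [eval_mul, eval_C, mul_assoc]

lemma wInner_comm (p q : ℝ[X]) : wInner w p q = wInner w q p := by
  unfold wInner
  simp only [mul_comm (eval _ p)]

lemma wInner_sub_left (hw_int : IntegrableOn w (Icc (-1 : ℝ) 1)) (p q r : ℝ[X]) :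
    wInner w (p - q) r = wInner w p r - wInner w q r := by
  have h := wInner_add_left hw_int (p - q) q r
  rw [sub_add_cancel] at h
  linarith

lemma wInner_sum_left (hw_int : IntegrableOn w (Icc (-1 : ℝ) 1)) {ι : Type*} (s : Finset ι)
    (p : ι → ℝ[X]) (q : ℝ[X]) : wInner w (∑ i ∈ s, p i) q = ∑ i ∈ s, wInner w (p i) q := by
  classical
  induction s using Finset.induction_on with
  | empty => simp [wInner]
  | insert a s ha ih => rw [Finset.sum_insert ha, Finset.sum_insert ha, wInner_add_left hw_int, ih]

lemma wInner_self_pos (hw_nonneg : ∀ t ∈ Icc (-1 : ℝ) 1, 0 ≤ w t)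
    (hw_int : IntegrableOn w (Icc (-1 : ℝ) 1)) (hw_pos : 0 < ∫ t in Icc (-1 : ℝ) 1, w t)
    {p : ℝ[X]} (hp : p ≠ 0) : 0 < wInner w p p := by
  have := integral_eval_mul_weight_pos hw_nonneg hw_int hw_pos (mul_ne_zero hp hp)
    fun t _ => by simpa using mul_self_nonneg (p.eval t)
  simpa [wInner] using this

lemma orthoPoly_monic_degree (w : ℝ → ℝ) (n : ℕ) :
    (orthoPoly w n).Monic ∧ (orthoPoly w n).degree = n := by
  induction n using Nat.strong_induction_on with
  | _ n ih =>
    have hlt : (∑ k : Fin n, C (wInner w (X ^ n) (orthoPoly w k) /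
        wInner w (orthoPoly w k) (orthoPoly w k)) * orthoPoly w k).degree <
        ((X : ℝ[X]) ^ n).degree := by
      rw [degree_X_pow]
      refine (degree_sum_le _ _).trans_lt
        ((Finset.sup_lt_iff (WithBot.bot_lt_coe n)).2 fun k _ => ?_)
      refine (degree_mul_le _ _).trans_lt ((add_le_add_left degree_C_le _).trans_lt ?_)
      rw [(ih k k.2).2, zero_add]
      exact Nat.cast_lt.2 k.2
    rw [orthoPoly]
    exact ⟨(monic_X_pow n).sub_of_left hlt,
      by rw [degree_sub_eq_left_of_degree_lt hlt, degree_X_pow]⟩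

lemma orthoPoly_monic (w : ℝ → ℝ) (n : ℕ) : (orthoPoly w n).Monic := (orthoPoly_monic_degree w n).1

lemma degree_orthoPoly (w : ℝ → ℝ) (n : ℕ) : (orthoPoly w n).degree = n :=
  (orthoPoly_monic_degree w n).2

lemma natDegree_orthoPoly (w : ℝ → ℝ) (n : ℕ) : (orthoPoly w n).natDegree = n :=
  natDegree_eq_of_degree_eq_some (degree_orthoPoly w n)

lemma wInner_orthoPoly_of_lt (hw_nonneg : ∀ t ∈ Icc (-1 : ℝ) 1, 0 ≤ w t)
    (hw_int : IntegrableOn w (Icc (-1 : ℝ) 1)) (hw_pos : 0 < ∫ t in Icc (-1 : ℝ) 1, w t)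
    (n : ℕ) : ∀ k < n, wInner w (orthoPoly w n) (orthoPoly w k) = 0 := by
  induction n using Nat.strong_induction_on with
  | _ n ih =>
    intro k hk
    have hk0 := (wInner_self_pos hw_nonneg hw_int hw_pos (orthoPoly_monic w k).ne_zero).ne'
    rw [orthoPoly, wInner_sub_left hw_int, wInner_sum_left hw_int, Finset.sum_eq_single ⟨k, hk⟩]
    · simp only [wInner_C_mul_left]
      field_simp
      rw [sub_self, mul_zero]
    · intro j _ hj
      rw [wInner_C_mul_left]
      rcases lt_trichotomy (j : ℕ) k with h | h | h
      · rw [wInner_comm (orthoPoly w j) (orthoPoly w k), ih k hk j h, mul_zero]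
      · exact absurd (Fin.ext h) hj
      · rw [ih j j.2 k h, mul_zero]
    · simp

/-- `p_n` is orthogonal to every polynomial of smaller degree. -/
lemma wInner_orthoPoly_of_degree_lt (hw_nonneg : ∀ t ∈ Icc (-1 : ℝ) 1, 0 ≤ w t)
    (hw_int : IntegrableOn w (Icc (-1 : ℝ) 1)) (hw_pos : 0 < ∫ t in Icc (-1 : ℝ) 1, w t)
    (n : ℕ) (q : ℝ[X]) (hq : q.degree < n) : wInner w q (orthoPoly w n) = 0 := by
  induction hd : q.natDegree using Nat.strong_induction_on generalizing q with
  | _ d ih =>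
    by_cases hq0 : q = 0
    · simp [hq0, wInner]
    have hdn : d < n := by rwa [degree_eq_natDegree hq0, Nat.cast_lt, hd] at hq
    set r := q - C q.leadingCoeff * orthoPoly w d with hr
    have hdeg : r.degree < q.degree := by
      refine degree_sub_lt_left ?_ hq0 ?_
      · rw [degree_C_mul (leadingCoeff_ne_zero.2 hq0), degree_orthoPoly, degree_eq_natDegree hq0,
          hd]
      · simp [(orthoPoly_monic w d).leadingCoeff]
    have hr0 : wInner w r (orthoPoly w n) = 0 := by
      by_cases hr00 : r = 0
      · simp [hr00, wInner]
      · exact ih r.natDegree (hd ▸ natDegree_lt_natDegree hr00 hdeg) r (hdeg.trans hq) rfl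
    have : q = r + C q.leadingCoeff * orthoPoly w d := by rw [hr]; ring
    rw [this, wInner_add_left hw_int, wInner_C_mul_left, hr0, wInner_comm,
      wInner_orthoPoly_of_lt hw_nonneg hw_int hw_pos n d hdn]
    simp

/-- If `q` divided `p_n` without change of sign on `[-1,1]`, then `p_n` would not be orthogonal
to the cofactor `r`, because the integrand `p_n r w = q r² w` has constant sign. -/
lemma not_dvd_orthoPoly_of_nonneg (hw_nonneg : ∀ t ∈ Icc (-1 : ℝ) 1, 0 ≤ w t)
    (hw_int : IntegrableOn w (Icc (-1 : ℝ) 1)) (hw_pos : 0 < ∫ t in Icc (-1 : ℝ) 1, w t)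
    (n : ℕ) (q : ℝ[X]) (hq : 0 < q.natDegree) (hq_nonneg : ∀ t ∈ Icc (-1 : ℝ) 1, 0 ≤ q.eval t) :
    ¬ q ∣ orthoPoly w n := by
  rintro ⟨r, hr⟩
  have hne := (orthoPoly_monic w n).ne_zero
  have hr0 : r ≠ 0 := by rintro rfl; simp [hne] at hr
  have hq0 : q ≠ 0 := by rintro rfl; simp at hq
  have hdeg : r.degree < n := by
    rw [degree_eq_natDegree hr0, Nat.cast_lt]
    have := natDegree_mul hq0 hr0
    rw [← hr, natDegree_orthoPoly] at this
    omega
  have h1 := wInner_orthoPoly_of_degree_lt hw_nonneg hw_int hw_pos n r hdeg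
  have h2 := integral_eval_mul_weight_pos hw_nonneg hw_int hw_pos
    (mul_ne_zero hq0 (mul_ne_zero hr0 hr0)) fun t ht => by
      simpa using mul_nonneg (hq_nonneg t ht) (mul_self_nonneg (r.eval t))
  refine h2.ne' (Eq.trans ?_ h1)
  unfold wInner
  rw [hr]
  congr 1 with t
  simp only [eval_mul]
  ring

/-- Every irreducible factor of `p_n` changes sign in `(-1,1)`, hence has a zero there. -/
lemma exists_root_of_irreducible_dvd_orthoPoly (hw_nonneg : ∀ t ∈ Icc (-1 : ℝ) 1, 0 ≤ w t)
    (hw_int : IntegrableOn w (Icc (-1 : ℝ) 1)) (hw_pos : 0 < ∫ t in Icc (-1 : ℝ) 1, w t)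
    (n : ℕ) (q : ℝ[X]) (hq : Irreducible q) (hdvd : q ∣ orthoPoly w n) :
    ∃ x ∈ Ioo (-1 : ℝ) 1, q.IsRoot x := by
  by_contra! hno
  have hneg : ∃ a ∈ Icc (-1 : ℝ) 1, q.eval a < 0 := by
    by_contra! h
    exact not_dvd_orthoPoly_of_nonneg hw_nonneg hw_int hw_pos n q hq.natDegree_pos h hdvd
  have hpos : ∃ a ∈ Icc (-1 : ℝ) 1, 0 < q.eval a := by
    by_contra! h
    refine not_dvd_orthoPoly_of_nonneg hw_nonneg hw_int hw_pos n (-q)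
      (by simpa using hq.natDegree_pos) (fun t ht => ?_) ((neg_dvd).2 hdvd)
    simpa using h t ht
  obtain ⟨a, ha, hqa⟩ := hneg
  obtain ⟨b, hb, hqb⟩ := hpos
  have hsub : uIcc a b ⊆ Icc (-1 : ℝ) 1 := uIcc_subset_Icc ha hb
  have h0 : (0 : ℝ) ∈ uIcc (q.eval a) (q.eval b) := by
    rw [uIcc_of_le (hqa.trans hqb).le]; exact ⟨hqa.le, hqb.le⟩
  obtain ⟨x, hx, hx0⟩ := intermediate_value_uIcc (q.continuous.continuousOn (s := uIcc a b)) h0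
  -- the endpoints of `[-1,1]` are excluded because `q` does not vanish at `a` and `b`
  have hxa : x ≠ a := by rintro rfl; exact hqa.ne hx0
  have hxb : x ≠ b := by rintro rfl; exact hqb.ne' hx0
  refine hno x ?_ hx0
  rcases le_total a b with hab | hab
  · rw [uIcc_of_le hab] at hx
    exact ⟨ha.1.trans_lt (hx.1.lt_of_ne' hxa), (hx.2.lt_of_ne hxb).trans_le hb.2⟩
  · rw [uIcc_of_ge hab] at hx
    exact ⟨hb.1.trans_lt (hx.1.lt_of_ne' hxb), (hx.2.lt_of_ne hxa).trans_le ha.2⟩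

/-- `p_n` has `n` distinct zeros in `(-1,1)`. -/
lemma exists_isZeroAngles (hw_nonneg : ∀ t ∈ Icc (-1 : ℝ) 1, 0 ≤ w t)
    (hw_int : IntegrableOn w (Icc (-1 : ℝ) 1)) (hw_pos : 0 < ∫ t in Icc (-1 : ℝ) 1, w t)
    (n : ℕ) : ∃ θ : Fin n → ℝ, IsZeroAngles w n θ := by
  set p := orthoPoly w n with hp
  have hne : p ≠ 0 := (orthoPoly_monic w n).ne_zero
  have hroot := exists_root_of_irreducible_dvd_orthoPoly hw_nonneg hw_int hw_pos n
  have hsplit : p.Splits := by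
    obtain ⟨u, hu⟩ := UniqueFactorizationMonoid.factors_prod hne
    rw [← hu]
    refine (Splits.multisetProd fun q hq => ?_).mul u.isUnit.splits
    have hq' := UniqueFactorizationMonoid.irreducible_of_factor q hq
    obtain ⟨x, -, hx⟩ := hroot q hq' (UniqueFactorizationMonoid.dvd_of_mem_factors hq)
    exact Splits.of_degree_eq_one (degree_eq_one_of_irreducible_of_root hq' hx)
  have hmem : ∀ x, p.IsRoot x → x ∈ Ioo (-1 : ℝ) 1 := fun x hx => by
    obtain ⟨y, hy, hyx⟩ := hroot (X - C x) (irreducible_X_sub_C x) (dvd_iff_isRoot.2 hx)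
    rw [root_X_sub_C] at hyx
    rwa [hyx]
  have hnodup : p.roots.Nodup := by
    rw [Multiset.nodup_iff_count_le_one]
    intro x
    by_contra! h
    rw [count_roots] at h
    have hd : (X - C x) ^ 2 ∣ p := (pow_dvd_pow _ h).trans (pow_rootMultiplicity_dvd p x)
    refine not_dvd_orthoPoly_of_nonneg hw_nonneg hw_int hw_pos n _ ?_ (fun t _ => ?_) hd
    · simp
    · simpa using sq_nonneg (t - x)
  have hcard : p.roots.toFinset.card = n := by
    rw [Multiset.toFinset_card_of_nodup hnodup, ← hsplit.natDegree_eq_card_roots,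
      natDegree_orthoPoly]
  have e := (p.roots.toFinset.equivFinOfCardEq hcard).symm
  have hI : ∀ k, p.IsRoot (e k : ℝ) := fun k => by
    have := (e k).2
    rw [Multiset.mem_toFinset, mem_roots hne] at this
    exact this
  have hcos : ∀ k, Real.cos (Real.arccos (e k)) = e k := fun k =>
    Real.cos_arccos (hmem _ (hI k)).1.le (hmem _ (hI k)).2.le
  refine ⟨fun k => Real.arccos (e k), fun j k hjk => ?_, fun k => ⟨⟨?_, ?_⟩, ?_⟩⟩
  · have := congrArg Real.cos hjk
    simp only [hcos] at this
    exact e.injective (Subtype.ext this)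
  · exact Real.arccos_pos.2 (hmem _ (hI k)).2
  · refine (Real.arccos_le_pi _).lt_of_ne fun h => ?_
    rw [Real.arccos_eq_pi] at h
    exact (hmem _ (hI k)).1.not_ge h
  · simp only [hcos]
    exact hI k

lemma IsZeroAngles.cos_injective {n : ℕ} {θ : Fin n → ℝ} (hθ : IsZeroAngles w n θ) :
    Function.Injective fun k => Real.cos (θ k) := fun j k hjk =>
  hθ.1 (Real.injOn_cos (Ioo_subset_Icc_self (hθ.2 j).1) (Ioo_subset_Icc_self (hθ.2 k).1) hjk)

/-- Gauss quadrature: after division by `p_n`, the quotient contributes nothing to either side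
and the remainder is integrated through its Lagrange interpolant. -/
lemma gauss_quadrature (hw_nonneg : ∀ t ∈ Icc (-1 : ℝ) 1, 0 ≤ w t)
    (hw_int : IntegrableOn w (Icc (-1 : ℝ) 1)) (hw_pos : 0 < ∫ t in Icc (-1 : ℝ) 1, w t)
    {n : ℕ} (hn : 1 ≤ n) {θ : Fin n → ℝ} (hθ : IsZeroAngles w n θ) (f : ℝ[X])
    (hf : f.natDegree ≤ 2 * n - 1) :
    cNorm w * ∫ t in Icc (-1 : ℝ) 1, f.eval t * w t =
      ∑ k, gaussWeight w θ k * f.eval (Real.cos (θ k)) := by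
  set p := orthoPoly w n with hp
  have hm : p.Monic := orthoPoly_monic w n
  set r := f %ₘ p
  set q := f /ₘ p
  have hfd : r + p * q = f := modByMonic_add_div f p
  have hq : q.degree < n := by
    refine lt_of_le_of_lt degree_le_natDegree ?_
    rw [Nat.cast_lt, natDegree_divByMonic f hm, natDegree_orthoPoly]
    omega
  have hr : r.degree < (Finset.univ : Finset (Fin n)).card := by
    rw [Finset.card_univ, Fintype.card_fin, ← degree_orthoPoly w n]
    exact degree_modByMonic_lt f hm
  have hr' := Lagrange.eq_interpolate (v := fun k => Real.cos (θ k)) hθ.cos_injective.injOn hr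
  have h1 : ∫ t in Icc (-1 : ℝ) 1, f.eval t * w t = ∫ t in Icc (-1 : ℝ) 1, r.eval t * w t := by
    have h0 := wInner_orthoPoly_of_degree_lt hw_nonneg hw_int hw_pos n q hq
    have : ∫ t in Icc (-1 : ℝ) 1, f.eval t * w t =
        (∫ t in Icc (-1 : ℝ) 1, r.eval t * w t) + wInner w q p := by
      rw [wInner, ← integral_add (integrableOn_eval_mul_weight hw_int r)
        (by simpa [IntegrableOn] using integrableOn_eval_mul_weight hw_int (q * p))]
      congr 1 with t
      rw [← hfd, eval_add, eval_mul]
      ring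
    rw [this, h0, add_zero]
  have h2 : ∀ k, f.eval (Real.cos (θ k)) = r.eval (Real.cos (θ k)) := fun k => by
    have : p.eval (Real.cos (θ k)) = 0 := (hθ.2 k).2
    rw [← hfd, eval_add, eval_mul, this]
    ring
  have h3 : ∀ t, r.eval t * w t = ∑ k, r.eval (Real.cos (θ k)) *
      ((Lagrange.basis Finset.univ (fun j => Real.cos (θ j)) k).eval t * w t) := fun t => by
    conv_lhs => rw [hr', Lagrange.interpolate_apply, eval_finsetSum, Finset.sum_mul]
    simp only [eval_mul, eval_C, mul_assoc]
  rw [h1, funext h3, integral_finsetSum _ fun k _ =>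
    (integrableOn_eval_mul_weight hw_int _).const_mul _, Finset.mul_sum]
  refine Finset.sum_congr rfl fun k _ => ?_
  rw [integral_const_mul, h2, gaussWeight]
  ring

end OneVariable

/-! ### Zero sets of polynomials are null sets -/

lemma continuous_evalAt (f : MvPolynomial (Fin 2) ℝ) : Continuous (evalAt f) := by
  unfold evalAt
  refine (MvPolynomial.continuous_eval f).comp (continuous_pi fun i => ?_)
  fin_cases i
  · exact continuous_fst
  · exact continuous_snd

/-- By Fubini: a nonzero `f` restricts to a nonzero polynomial in the second variable on all but
finitely many vertical lines, since it cannot vanish on an infinite box. -/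
lemma volume_evalAt_eq_zero {f : MvPolynomial (Fin 2) ℝ} (hf : f ≠ 0) :
    volume {z : ℝ × ℝ | evalAt f z = 0} = 0 := by
  have hmeas : MeasurableSet {z : ℝ × ℝ | evalAt f z = 0} :=
    (isClosed_eq (continuous_evalAt f) continuous_const).measurableSet
  let q : ℝ → ℝ[X] := fun x => MvPolynomial.eval₂ C ![C x, X] f
  have hq : ∀ x y, (q x).eval y = evalAt f (x, y) := fun x y => by
    have h : (Polynomial.evalRingHom y).comp C = RingHom.id ℝ := by ext; simp
    change Polynomial.evalRingHom y (MvPolynomial.eval₂ C ![C x, X] f) = _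
    rw [MvPolynomial.eval₂_comp_left, h, evalAt, MvPolynomial.eval, MvPolynomial.coe_eval₂Hom]
    congr 1
    ext i
    fin_cases i <;> simp
  have hfin : {x | q x = 0}.Finite := by
    by_contra hinf
    refine hf (MvPolynomial.funext_set ![{x | q x = 0}, univ] (fun i => ?_) fun z hz => ?_)
    · fin_cases i
      · exact hinf
      · exact infinite_univ
    · have h0 : q (z 0) = 0 := hz 0 (mem_univ _)
      have h1 := hq (z 0) (z 1)
      have hz' : ![z 0, z 1] = z := by ext i; fin_cases i <;> rfl
      rw [h0, evalAt, hz', eval_zero] at h1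
      simp [← h1]
  change (volume.prod volume) _ = 0
  rw [Measure.measure_prod_null hmeas]
  have hae : ∀ᵐ x ∂(volume : Measure ℝ), q x ≠ 0 := by
    rw [ae_iff]
    simpa using hfin.measure_zero _
  filter_upwards [hae] with x hx
  refine Finite.measure_zero (((q x).roots.toFinset.finite_toSet).subset fun y hy => ?_) _
  have : (q x).eval y = 0 := (hq x y).trans hy
  simpa [hx] using this

lemma ae_boundary_ne_zero : ∀ᵐ z : ℝ × ℝ,
    (z.1 - z.2) * (z.1 + z.2) * (1 - z.1 ^ 2) * (1 - z.2 ^ 2) ≠ 0 := by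
  let p : MvPolynomial (Fin 2) ℝ := (.X 0 - .X 1) * (.X 0 + .X 1) * (1 - .X 0 ^ 2) * (1 - .X 1 ^ 2)
  have hp : ∀ z, evalAt p z = (z.1 - z.2) * (z.1 + z.2) * (1 - z.1 ^ 2) * (1 - z.2 ^ 2) := by
    intro z
    simp [p, evalAt]
  have hp0 : p ≠ 0 := by
    intro h
    have h1 := hp (2, 0)
    rw [h] at h1
    norm_num [evalAt] at h1
  rw [ae_iff]
  simpa only [hp, not_not] using volume_evalAt_eq_zero hp0

/-! ### Integration over the square, the triangle and the sector -/

/-- The triangle `-1 < x < y < 1`. -/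
def triangle : Set (ℝ × ℝ) := {z | -1 < z.1 ∧ z.1 < z.2 ∧ z.2 < 1}

/-- The quarter `|x| < y < 1` of the square. -/
def sector : Set (ℝ × ℝ) := {z | -z.2 < z.1 ∧ z.1 < z.2 ∧ z.2 < 1}

lemma measurableSet_triangle : MeasurableSet triangle :=
  (isOpen_lt continuous_const continuous_fst).measurableSet.inter
    ((isOpen_lt continuous_fst continuous_snd).measurableSet.inter
      (isOpen_lt continuous_snd continuous_const).measurableSet)

lemma measurableSet_sector : MeasurableSet sector :=
  (isOpen_lt continuous_snd.neg continuous_fst).measurableSet.inter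
    ((isOpen_lt continuous_fst continuous_snd).measurableSet.inter
      (isOpen_lt continuous_snd continuous_const).measurableSet)

/-- Integration over a domain that is cut into two halves exchanged by an involution. -/
lemma setIntegral_eq_of_involution {A B : Set (ℝ × ℝ)} (σ : ℝ × ℝ ≃ᵐ ℝ × ℝ)
    (hσ : MeasurePreserving σ volume volume) (hσσ : ∀ z, σ (σ z) = z) (hB : MeasurableSet B)
    (hA : A =ᵐ[volume] (B ∪ σ ⁻¹' B : Set (ℝ × ℝ))) (hd : Disjoint B (σ ⁻¹' B)) {F : ℝ × ℝ → ℝ}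
    (hF : IntegrableOn F B) (hFσ : IntegrableOn (fun z => F (σ z)) B) :
    IntegrableOn F A ∧ ∫ z in A, F z = ∫ z in B, (F z + F (σ z)) := by
  have hF' : IntegrableOn F (σ ⁻¹' B) := by
    have := (hσ.integrableOn_comp_preimage σ.measurableEmbedding (s := B)).2 hFσ
    simpa only [Function.comp_def, hσσ] using this
  refine ⟨(hF.union hF').congr_set_ae hA, ?_⟩
  rw [setIntegral_congr_set hA, setIntegral_union hd (σ.measurable hB) hF hF',
    integral_add hF hFσ, ← hσ.setIntegral_preimage_emb σ.measurableEmbedding fun z => F (σ z)]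
  simp only [hσσ]

/-- The reflection `(x, y) ↦ (y, x)`. -/
def swapEquiv : ℝ × ℝ ≃ᵐ ℝ × ℝ := MeasurableEquiv.prodComm

/-- The reflection `(x, y) ↦ (-y, -x)`. -/
def negSwapEquiv : ℝ × ℝ ≃ᵐ ℝ × ℝ := MeasurableEquiv.prodComm.trans (MeasurableEquiv.neg _)

@[simp] lemma swapEquiv_apply (z : ℝ × ℝ) : swapEquiv z = (z.2, z.1) := rfl

@[simp] lemma negSwapEquiv_apply (z : ℝ × ℝ) : negSwapEquiv z = (-z.2, -z.1) := rfl

lemma measurePreserving_swapEquiv : MeasurePreserving swapEquiv volume volume :=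
  Measure.measurePreserving_swap

lemma measurePreserving_negSwapEquiv : MeasurePreserving negSwapEquiv volume volume :=
  (Measure.measurePreserving_neg (volume.prod volume)).comp Measure.measurePreserving_swap

lemma setIntegral_square_eq_triangle {F : ℝ × ℝ → ℝ} (hF : IntegrableOn F triangle)
    (hF' : IntegrableOn (fun z => F (z.2, z.1)) triangle) :
    IntegrableOn F square ∧ ∫ z in square, F z = ∫ z in triangle, (F z + F (z.2, z.1)) := by
  refine setIntegral_eq_of_involution swapEquiv measurePreserving_swapEquiv (fun _ => rfl)
    measurableSet_triangle ?_ ?_ hF hF'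
  · refine Filter.eventuallyEq_set.2 ?_
    filter_upwards [ae_boundary_ne_zero] with z hz
    simp only [ne_eq, mul_eq_zero, not_or, sub_eq_zero] at hz
    obtain ⟨⟨⟨h1, -⟩, h2⟩, h3⟩ := hz
    simp only [square, triangle, mem_union, mem_preimage, swapEquiv_apply, mem_ofPred_eq, mem_prod,
      mem_Icc]
    constructor
    · rintro ⟨⟨ha, hb⟩, hc, hd⟩
      have ha' := ha.lt_of_ne (by rintro h; rw [← h] at h2; norm_num at h2)
      have hb' := hb.lt_of_ne (by rintro h; rw [h] at h2; norm_num at h2)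
      have hc' := hc.lt_of_ne (by rintro h; rw [← h] at h3; norm_num at h3)
      have hd' := hd.lt_of_ne (by rintro h; rw [h] at h3; norm_num at h3)
      rcases lt_or_gt_of_ne h1 with h | h
      · exact .inl ⟨ha', h, hd'⟩
      · exact .inr ⟨hc', h, hb'⟩
    · rintro (⟨ha, hb, hc⟩ | ⟨ha, hb, hc⟩) <;> refine ⟨⟨?_, ?_⟩, ?_, ?_⟩ <;> linarith
  · rw [Set.disjoint_left]
    rintro z ⟨-, h, -⟩ ⟨-, h', -⟩
    exact lt_asymm h h'

lemma setIntegral_triangle_eq_sector {F : ℝ × ℝ → ℝ} (hF : IntegrableOn F sector)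
    (hF' : IntegrableOn (fun z => F (-z.2, -z.1)) sector) :
    IntegrableOn F triangle ∧ ∫ z in triangle, F z = ∫ z in sector, (F z + F (-z.2, -z.1)) := by
  refine setIntegral_eq_of_involution negSwapEquiv measurePreserving_negSwapEquiv
    (fun z => by simp) measurableSet_sector ?_ ?_ hF hF'
  · refine Filter.eventuallyEq_set.2 ?_
    filter_upwards [ae_boundary_ne_zero] with z hz
    simp only [ne_eq, mul_eq_zero, not_or] at hz
    obtain ⟨⟨⟨-, h1⟩, -⟩, -⟩ := hz
    simp only [sector, triangle, mem_union, mem_preimage, negSwapEquiv_apply, mem_ofPred_eq]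
    constructor
    · rintro ⟨ha, hb, hc⟩
      rcases lt_or_gt_of_ne h1 with h | h
      · exact .inr ⟨by linarith, by linarith, by linarith⟩
      · exact .inl ⟨by linarith, by linarith, by linarith⟩
    · rintro (⟨ha, hb, hc⟩ | ⟨ha, hb, hc⟩) <;> refine ⟨?_, ?_, ?_⟩ <;> linarith
  · rw [Set.disjoint_left]
    rintro z ⟨h, -, -⟩ ⟨h', -, -⟩
    simp only [negSwapEquiv_apply, neg_neg] at h'
    linarith

/-! ### The two parametrizations of `Ω` -/

/-- The map `(x, y) ↦ (x + y, x y)`. -/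
def symMap (z : ℝ × ℝ) : ℝ × ℝ := (z.1 + z.2, z.1 * z.2)

/-- The map `(x, y) ↦ (2 x y, x² + y² - 1)`. -/
def foldMap (z : ℝ × ℝ) : ℝ × ℝ := (2 * z.1 * z.2, z.1 ^ 2 + z.2 ^ 2 - 1)

/-- The derivative of `symMap`. -/
def symMapDeriv (z : ℝ × ℝ) : ℝ × ℝ →L[ℝ] ℝ × ℝ :=
  (Matrix.toLin (.finTwoProd ℝ) (.finTwoProd ℝ) !![1, 1; z.2, z.1]).toContinuousLinearMap

/-- The derivative of `foldMap`. -/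
def foldMapDeriv (z : ℝ × ℝ) : ℝ × ℝ →L[ℝ] ℝ × ℝ :=
  (Matrix.toLin (.finTwoProd ℝ) (.finTwoProd ℝ)
    !![2 * z.2, 2 * z.1; 2 * z.1, 2 * z.2]).toContinuousLinearMap

lemma hasFDerivAt_symMap (z : ℝ × ℝ) : HasFDerivAt symMap (symMapDeriv z) z := by
  unfold symMapDeriv
  rw [Matrix.toLin_finTwoProd_toContinuousLinearMap]
  refine ((hasFDerivAt_fst.add hasFDerivAt_snd).prodMk
    (hasFDerivAt_fst.mul hasFDerivAt_snd)).congr_fderiv ?_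
  ext <;> simp

lemma hasFDerivAt_foldMap (z : ℝ × ℝ) : HasFDerivAt foldMap (foldMapDeriv z) z := by
  unfold foldMapDeriv
  rw [Matrix.toLin_finTwoProd_toContinuousLinearMap]
  refine (((hasFDerivAt_fst.const_mul 2).mul hasFDerivAt_snd).prodMk
    (((hasFDerivAt_fst.pow 2).add (hasFDerivAt_snd.pow 2)).sub_const 1)).congr_fderiv ?_
  ext <;> simp [mul_comm]

lemma det_symMapDeriv (z : ℝ × ℝ) : (symMapDeriv z).det = z.1 - z.2 := by
  simp only [symMapDeriv, LinearMap.det_toContinuousLinearMap, LinearMap.det_toLin,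
    Matrix.det_fin_two_of]
  ring

lemma det_foldMapDeriv (z : ℝ × ℝ) : (foldMapDeriv z).det = -4 * (z.1 ^ 2 - z.2 ^ 2) := by
  simp only [foldMapDeriv, LinearMap.det_toContinuousLinearMap, LinearMap.det_toLin,
    Matrix.det_fin_two_of]
  ring

lemma injOn_symMap : InjOn symMap triangle := by
  rintro ⟨x, y⟩ ⟨-, h, -⟩ ⟨x', y'⟩ ⟨-, h', -⟩ heq
  simp only [symMap, Prod.mk.injEq] at heq h h'
  obtain ⟨h1, h2⟩ := heq
  have h3 : (x - x') * (x - y') = 0 := by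
    have : y' = x + y - x' := by linarith
    subst this
    linear_combination -h2
  rcases mul_eq_zero.1 h3 with h4 | h4 <;> ext <;> simp only <;> linarith

lemma injOn_foldMap : InjOn foldMap sector := by
  rintro ⟨x, y⟩ ⟨h1, h2, -⟩ ⟨x', y'⟩ ⟨h1', h2', -⟩ heq
  simp only [foldMap, Prod.mk.injEq] at heq h1 h2 h1' h2'
  obtain ⟨h3, h4⟩ := heq
  have h5 : x + y = x' + y' := by
    refine (sq_eq_sq₀ (by linarith) (by linarith)).1 ?_
    linear_combination h3 + h4
  have h6 : y - x = y' - x' := by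
    refine (sq_eq_sq₀ (by linarith) (by linarith)).1 ?_
    linear_combination h4 - h3
  ext <;> simp only <;> linarith

lemma image_symMap : symMap '' triangle = Omega := by
  ext ⟨u, v⟩
  simp only [mem_image, Prod.exists, symMap, triangle, Omega, mem_ofPred_eq, Prod.mk.injEq]
  constructor
  · rintro ⟨x, y, ⟨h1, h2, h3⟩, rfl, rfl⟩
    refine ⟨by nlinarith, by nlinarith, by nlinarith [mul_pos (sub_pos.2 h2) (sub_pos.2 h2)], ?_⟩
    rw [abs_lt]
    constructor <;> linarith
  · rintro ⟨h1, h2, h3, h4⟩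
    rw [abs_lt] at h4
    have hpos : 0 < u ^ 2 - 4 * v := by linarith
    have hs := Real.sqrt_pos.2 hpos
    have hs2 := Real.sq_sqrt hpos.le
    have hu : √(u ^ 2 - 4 * v) < u + 2 := by
      rw [Real.sqrt_lt' (by linarith)]; nlinarith
    have hu' : √(u ^ 2 - 4 * v) < 2 - u := by
      rw [Real.sqrt_lt' (by linarith)]; nlinarith
    refine ⟨(u - √(u ^ 2 - 4 * v)) / 2, (u + √(u ^ 2 - 4 * v)) / 2,
      ⟨by linarith, by linarith, by linarith⟩, by ring, ?_⟩
    linear_combination (-1 / 4) * hs2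

lemma image_foldMap : foldMap '' sector = Omega := by
  ext ⟨u, v⟩
  simp only [mem_image, Prod.exists, foldMap, sector, Omega, mem_ofPred_eq, Prod.mk.injEq]
  constructor
  · rintro ⟨x, y, ⟨h1, h2, h3⟩, rfl, rfl⟩
    have hx : 0 < 1 - x ^ 2 := by nlinarith
    have hy : 0 < 1 - y ^ 2 := by nlinarith
    refine ⟨by nlinarith [mul_pos (by linarith : 0 < x + y) (by linarith : 0 < x + y)],
      by nlinarith [mul_pos (by linarith : 0 < y - x) (by linarith : 0 < y - x)],
      by nlinarith [mul_pos hx hy], ?_⟩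
    rw [abs_lt]
    constructor <;> nlinarith [sq_nonneg (x + y), sq_nonneg (x - y)]
  · rintro ⟨h1, h2, h3, h4⟩
    rw [abs_lt] at h4
    have ha := Real.sqrt_pos.2 h1
    have hb := Real.sqrt_pos.2 h2
    have ha2 := Real.sq_sqrt h1.le
    have hb2 := Real.sq_sqrt h2.le
    set a := √(1 + u + v)
    set b := √(1 - u + v)
    refine ⟨(a - b) / 2, (a + b) / 2, ⟨by linarith, by linarith, ?_⟩, ?_, ?_⟩
    · have hv : v < 1 := by nlinarith
      -- `(a b)² = (1 + v)² - u² < (1 - v)²`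
      have hab : a * b < 1 - v := by
        refine lt_of_pow_lt_pow_left₀ 2 (by linarith) ?_
        rw [mul_pow, ha2, hb2]
        nlinarith
      nlinarith
    · linear_combination (1 / 2) * ha2 - (1 / 2) * hb2
    · linear_combination (1 / 2) * ha2 + (1 / 2) * hb2

lemma setIntegral_Omega_eq_triangle (g : ℝ × ℝ → ℝ) :
    (IntegrableOn g Omega ↔ IntegrableOn (fun z => |z.1 - z.2| * g (symMap z)) triangle) ∧
      ∫ z in Omega, g z = ∫ z in triangle, |z.1 - z.2| * g (symMap z) := by
  have h : ∀ z ∈ triangle, HasFDerivWithinAt symMap (symMapDeriv z) triangle z := fun z _ =>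
    (hasFDerivAt_symMap z).hasFDerivWithinAt
  rw [← image_symMap, integral_image_eq_integral_abs_det_fderiv_smul volume measurableSet_triangle h
    injOn_symMap, integrableOn_image_iff_integrableOn_abs_det_fderiv_smul volume
    measurableSet_triangle h injOn_symMap]
  simp only [det_symMapDeriv, smul_eq_mul, and_self]

lemma setIntegral_Omega_eq_sector (g : ℝ × ℝ → ℝ) :
    (IntegrableOn g Omega ↔
      IntegrableOn (fun z => 4 * |z.1 ^ 2 - z.2 ^ 2| * g (foldMap z)) sector) ∧
      ∫ z in Omega, g z = ∫ z in sector, 4 * |z.1 ^ 2 - z.2 ^ 2| * g (foldMap z) := by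
  have h : ∀ z ∈ sector, HasFDerivWithinAt foldMap (foldMapDeriv z) sector z := fun z _ =>
    (hasFDerivAt_foldMap z).hasFDerivWithinAt
  rw [← image_foldMap, integral_image_eq_integral_abs_det_fderiv_smul volume measurableSet_sector h
    injOn_foldMap, integrableOn_image_iff_integrableOn_abs_det_fderiv_smul volume
    measurableSet_sector h injOn_foldMap]
  simp only [det_foldMapDeriv, smul_eq_mul, abs_mul, abs_neg, Nat.abs_ofNat, and_self]

/-! ### Reduction of the integral for `𝒲_γ` to a product integral -/

section Reduction

variable {w : ℝ → ℝ}

lemma integrableOn_square_mul_weight (hw_int : IntegrableOn w (Icc (-1 : ℝ) 1)) {h : ℝ × ℝ → ℝ}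
    (hh : Continuous h) : IntegrableOn (fun z => h z * (w z.1 * w z.2)) square := by
  have : IntegrableOn (fun z : ℝ × ℝ => w z.1 * w z.2) square := by
    have := Integrable.mul_prod hw_int hw_int
    rwa [Measure.prod_restrict] at this
  exact this.continuousOn_mul hh.continuousOn (isCompact_Icc.prod isCompact_Icc)

lemma triangle_subset_square : triangle ⊆ square := by
  rintro z ⟨h1, h2, h3⟩
  exact ⟨⟨h1.le, by linarith⟩, by linarith, h3.le⟩

lemma sector_subset_square : sector ⊆ square := by
  rintro z ⟨h1, h2, h3⟩
  exact ⟨⟨by linarith, by linarith⟩, by linarith, h3.le⟩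

/-- On the triangle, the Jacobian `|x - y|` of `symMap` raises the exponent from `γ` to
`γ + 1/2`, so that `(x - y)²` occurs with the integer exponent `e`. -/
lemma abs_sub_mul_preWeight_symMap (w : ℝ → ℝ) (e : ℕ) {z : ℝ × ℝ} (hz : z ∈ triangle) :
    |z.1 - z.2| * preWeight w (e - 1 / 2) (symMap z) =
      (z.1 - z.2) ^ (2 * e) * (w z.1 * w z.2) := by
  obtain ⟨-, h, -⟩ := hz
  have hpos : 0 < z.2 - z.1 := sub_pos.2 h
  have hsq : (z.1 + z.2) ^ 2 - 4 * (z.1 * z.2) = (z.2 - z.1) ^ 2 := by ring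
  have hrpow : ((z.2 - z.1) ^ 2) ^ ((e : ℝ) - 1 / 2) * (z.2 - z.1) = (z.2 - z.1) ^ (2 * e) := by
    rw [← Real.rpow_natCast (z.2 - z.1) 2, ← Real.rpow_mul hpos.le, ← Real.rpow_add_one hpos.ne',
      ← Real.rpow_natCast]
    congr 1
    push_cast
    ring
  rw [abs_sub_comm, abs_of_pos hpos]
  simp only [preWeight, symMap, hsq, Real.sqrt_sq hpos.le]
  have h1 : (z.1 + z.2 + (z.2 - z.1)) / 2 = z.2 := by ring
  have h2 : (z.1 + z.2 - (z.2 - z.1)) / 2 = z.1 := by ring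
  have h3 : (z.1 - z.2) ^ (2 * e) = (z.2 - z.1) ^ (2 * e) := by
    rw [pow_mul, pow_mul]; congr 1; ring
  rw [h1, h2, h3, ← hrpow]
  ring

lemma setIntegral_Omega_mul_preWeight (hw_int : IntegrableOn w (Icc (-1 : ℝ) 1)) (e : ℕ)
    {G : ℝ × ℝ → ℝ} (hG : Continuous fun z => G (symMap z)) :
    IntegrableOn (fun z => G z * preWeight w (e - 1 / 2) z) Omega ∧
      ∫ z in Omega, G z * preWeight w (e - 1 / 2) z =
        1 / 2 * ∫ z in square, G (symMap z) * (z.1 - z.2) ^ (2 * e) * (w z.1 * w z.2) := by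
  have hcont : Continuous fun z : ℝ × ℝ => G (symMap z) * (z.1 - z.2) ^ (2 * e) :=
    hG.mul (by fun_prop)
  have hint := integrableOn_square_mul_weight hw_int hcont
  have heq : EqOn (fun z => |z.1 - z.2| * (G (symMap z) * preWeight w (e - 1 / 2) (symMap z)))
      (fun z => G (symMap z) * (z.1 - z.2) ^ (2 * e) * (w z.1 * w z.2)) triangle := by
    intro z hz
    have := abs_sub_mul_preWeight_symMap w e hz
    simp only
    linear_combination G (symMap z) * this
  have hsymm : ∀ z : ℝ × ℝ, G (symMap (z.2, z.1)) * (z.2 - z.1) ^ (2 * e) * (w z.2 * w z.1) =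
      G (symMap z) * (z.1 - z.2) ^ (2 * e) * (w z.1 * w z.2) := fun z => by
    have h1 : symMap (z.2, z.1) = symMap z := by simp [symMap, add_comm, mul_comm]
    have h2 : (z.2 - z.1) ^ (2 * e) = (z.1 - z.2) ^ (2 * e) := by
      rw [pow_mul, pow_mul]; congr 1; ring
    rw [h1, h2, mul_comm (w z.2)]
  have hT := hint.mono_set triangle_subset_square
  obtain ⟨h1, h2⟩ := setIntegral_Omega_eq_triangle fun z => G z * preWeight w (e - 1 / 2) z
  refine ⟨h1.2 (hT.congr_fun heq.symm measurableSet_triangle), ?_⟩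
  obtain ⟨-, h3⟩ := setIntegral_square_eq_triangle hT (by simpa only [hsymm] using hT)
  rw [h2, setIntegral_congr_fun measurableSet_triangle heq, h3]
  simp only [hsymm, ← two_mul]
  rw [integral_const_mul]
  ring

lemma weightCW_swap (w : ℝ → ℝ) (γ : ℝ) (z : ℝ × ℝ) :
    weightCW w γ (z.2, z.1) = weightCW w γ z := by
  simp only [weightCW]
  rw [abs_sub_comm]
  congr 3
  · ring
  · ring

lemma weightCW_neg (w : ℝ → ℝ) (γ : ℝ) (z : ℝ × ℝ) :
    weightCW w γ (-z.1, -z.2) = weightCW w γ z := by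
  simp [weightCW]

lemma weightCW_neg_swap (w : ℝ → ℝ) (γ : ℝ) (z : ℝ × ℝ) :
    weightCW w γ (-z.2, -z.1) = weightCW w γ z :=
  (weightCW_neg w γ (z.2, z.1)).trans (weightCW_swap w γ z)

lemma integrableOn_weightCW (hw_int : IntegrableOn w (Icc (-1 : ℝ) 1)) (e : ℕ) :
    IntegrableOn (weightCW w (e - 1 / 2)) square := by
  have h1 : IntegrableOn (weightW w (e - 1 / 2)) Omega := by
    have := (setIntegral_Omega_mul_preWeight hw_int e (G := fun _ => 1) continuous_const).1
    simp only [one_mul] at this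
    exact this.const_mul _
  have h2 : IntegrableOn (weightCW w (e - 1 / 2)) sector := by
    have h3 : weightCW w (e - 1 / 2) = fun z =>
        1 / 4 * (4 * |z.1 ^ 2 - z.2 ^ 2| * weightW w (e - 1 / 2) (foldMap z)) := by
      ext z
      simp only [weightCW, foldMap]
      ring
    rw [h3]
    exact ((setIntegral_Omega_eq_sector _).1.1 h1).const_mul (1 / 4)
  have h3 := (setIntegral_triangle_eq_sector h2 (by simpa only [weightCW_neg_swap] using h2)).1
  exact (setIntegral_square_eq_triangle h3 (by simpa only [weightCW_swap] using h3)).1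

lemma integrableOn_mul_weightCW (hw_int : IntegrableOn w (Icc (-1 : ℝ) 1)) (e : ℕ) {F : ℝ × ℝ → ℝ}
    (hF : Continuous F) : IntegrableOn (fun z => F z * weightCW w (e - 1 / 2) z) square :=
  (integrableOn_weightCW hw_int e).continuousOn_mul hF.continuousOn
    (isCompact_Icc.prod isCompact_Icc)

/-- If the sum of `F` over the four symmetries of `𝒲_γ` is the pull-back of `G` under `foldMap`,
then the integral of `F` becomes an integral for the product weight `w(x) w(y)`. -/
lemma setIntegral_square_mul_weightCW (hw_int : IntegrableOn w (Icc (-1 : ℝ) 1)) (e : ℕ)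
    {F G : ℝ × ℝ → ℝ} (hF : Continuous F) (hG : Continuous fun z => G (symMap z))
    (hFG : ∀ s t, F (s, t) + F (t, s) + F (-s, -t) + F (-t, -s) = G (foldMap (s, t))) :
    ∫ z in square, F z * weightCW w (e - 1 / 2) z = bNorm w (e - 1 / 2) / 8 *
      ∫ z in square, G (symMap z) * (z.1 - z.2) ^ (2 * e) * (w z.1 * w z.2) := by
  have hI : ∀ F' : ℝ × ℝ → ℝ, Continuous F' →
      IntegrableOn (fun z => F' z * weightCW w (e - 1 / 2) z) square := fun F' hF' =>
    integrableOn_mul_weightCW hw_int e hF'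
  have h1 := (setIntegral_square_eq_triangle ((hI F hF).mono_set triangle_subset_square) (by
    simpa only [weightCW_swap] using (hI (fun z => F (z.2, z.1)) (by fun_prop)).mono_set
      triangle_subset_square)).2
  simp only [weightCW_swap, ← add_mul] at h1
  have h2 := (setIntegral_triangle_eq_sector
    ((hI (fun z => F z + F (z.2, z.1)) (by fun_prop)).mono_set sector_subset_square) (by
    simpa only [weightCW_neg_swap] using
      (hI (fun z => F (-z.2, -z.1) + F (-z.1, -z.2)) (by fun_prop)).mono_set
      sector_subset_square)).2
  simp only [weightCW_neg_swap, ← add_mul] at h2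
  have h3 := (setIntegral_Omega_eq_sector fun z => G z * weightW w (e - 1 / 2) z).2
  have h4 : ∀ z : ℝ × ℝ, (F z + F (z.2, z.1) + (F (-z.2, -z.1) + F (-z.1, -z.2))) *
      weightCW w (e - 1 / 2) z = 1 / 4 * (4 * |z.1 ^ 2 - z.2 ^ 2| *
        (G (foldMap z) * weightW w (e - 1 / 2) (foldMap z))) := fun z => by
    have := hFG z.1 z.2
    rw [Prod.mk.eta] at this
    rw [← this, weightCW, foldMap]
    ring
  rw [h1, h2]
  simp only [h4]
  rw [integral_const_mul, ← h3]
  have h5 : ∀ z, G z * weightW w (e - 1 / 2) z =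
      bNorm w (e - 1 / 2) * (G z * preWeight w (e - 1 / 2) z) := fun z => by
    rw [weightW]; ring
  simp only [h5]
  rw [integral_const_mul, (setIntegral_Omega_mul_preWeight hw_int e hG).2]
  ring

end Reduction

/-! ### Symmetric functions and their degree in each variable -/

/-- The space of polynomial functions `h(x, y)` of degree at most `d` in each of the variables. -/
def biDegreeLE (d : ℕ) : Submodule ℝ (ℝ × ℝ → ℝ) :=
  Submodule.span ℝ {h | ∃ i ≤ d, ∃ j ≤ d, h = fun z => z.1 ^ i * z.2 ^ j}

lemma pow_mul_pow_mem_biDegreeLE {d i j : ℕ} (hi : i ≤ d) (hj : j ≤ d) :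
    (fun z : ℝ × ℝ => z.1 ^ i * z.2 ^ j) ∈ biDegreeLE d :=
  Submodule.subset_span ⟨i, hi, j, hj, rfl⟩

lemma biDegreeLE_mono {d d' : ℕ} (h : d ≤ d') : biDegreeLE d ≤ biDegreeLE d' :=
  Submodule.span_mono fun _ ⟨i, hi, j, hj, hh⟩ => ⟨i, hi.trans h, j, hj.trans h, hh⟩

lemma mul_mem_biDegreeLE {d d' : ℕ} {f g : ℝ × ℝ → ℝ} (hf : f ∈ biDegreeLE d)
    (hg : g ∈ biDegreeLE d') : f * g ∈ biDegreeLE (d + d') := by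
  have h := Submodule.mul_mem_mul hf hg
  rw [biDegreeLE, biDegreeLE, Submodule.span_mul_span] at h
  refine Submodule.span_mono ?_ h
  rintro _ ⟨_, ⟨i, hi, j, hj, rfl⟩, _, ⟨i', hi', j', hj', rfl⟩, rfl⟩
  refine ⟨i + i', add_le_add hi hi', j + j', add_le_add hj hj', ?_⟩
  ext z
  simp only [Pi.mul_apply]
  ring

lemma one_mem_biDegreeLE (d : ℕ) : (1 : ℝ × ℝ → ℝ) ∈ biDegreeLE d := by
  convert pow_mul_pow_mem_biDegreeLE (Nat.zero_le d) (Nat.zero_le d) using 1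
  ext; simp

lemma pow_mem_biDegreeLE {d : ℕ} {f : ℝ × ℝ → ℝ} (hf : f ∈ biDegreeLE d) (m : ℕ) :
    f ^ m ∈ biDegreeLE (m * d) := by
  induction m with
  | zero => simpa using one_mem_biDegreeLE 0
  | succ m ih => rw [pow_succ, Nat.succ_mul]; exact mul_mem_biDegreeLE ih hf

lemma fst_mem_biDegreeLE : (fun z : ℝ × ℝ => z.1) ∈ biDegreeLE 1 := by
  simpa using pow_mul_pow_mem_biDegreeLE (d := 1) (i := 1) (j := 0) le_rfl zero_le_one

lemma snd_mem_biDegreeLE : (fun z : ℝ × ℝ => z.2) ∈ biDegreeLE 1 := by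
  simpa using pow_mul_pow_mem_biDegreeLE (d := 1) (i := 0) (j := 1) zero_le_one le_rfl

lemma half_add_mem_biDegreeLE : (fun z : ℝ × ℝ => (z.1 + z.2) / 2) ∈ biDegreeLE 1 := by
  have := (biDegreeLE 1).smul_mem (1 / 2) (add_mem fst_mem_biDegreeLE snd_mem_biDegreeLE)
  convert this using 1
  ext z
  simp only [Pi.smul_apply, Pi.add_apply, smul_eq_mul]
  ring

lemma continuous_of_mem_biDegreeLE {d : ℕ} {f : ℝ × ℝ → ℝ} (hf : f ∈ biDegreeLE d) :
    Continuous f := by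
  induction hf using Submodule.span_induction with
  | mem x h => obtain ⟨i, -, j, -, rfl⟩ := h; fun_prop
  | zero => exact continuous_const
  | add x y _ _ hx hy => exact hx.add hy
  | smul a x _ hx => exact hx.const_smul a

/-- The power sum `s^{2k} + t^{2k}` as a function of `(2 s t, s² + t² - 1)`, by Newton's
recursion. -/
def evenPowerSum : ℕ → ℝ × ℝ → ℝ
  | 0, _ => 2
  | 1, z => z.2 + 1
  | k + 2, z => (z.2 + 1) * evenPowerSum (k + 1) z - (z.1 / 2) ^ 2 * evenPowerSum k z

lemma evenPowerSum_foldMap (s t : ℝ) (k : ℕ) :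
    evenPowerSum k (foldMap (s, t)) = s ^ (2 * k) + t ^ (2 * k) := by
  induction k using Nat.twoStepInduction with
  | zero => norm_num [evenPowerSum]
  | one => simp [evenPowerSum, foldMap]
  | more k h0 h1 =>
    rw [evenPowerSum, h0, h1]
    simp only [foldMap]
    ring

lemma evenPowerSum_symMap_mem (k : ℕ) : evenPowerSum k ∘ symMap ∈ biDegreeLE k := by
  have hv : (fun z : ℝ × ℝ => z.1 * z.2 + 1) ∈ biDegreeLE 1 := by
    have := pow_mul_pow_mem_biDegreeLE (d := 1) le_rfl le_rfl
    convert add_mem this (one_mem_biDegreeLE 1) using 1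
    ext z
    simp
  induction k using Nat.twoStepInduction with
  | zero =>
    convert (biDegreeLE 0).smul_mem 2 (one_mem_biDegreeLE 0) using 1
    ext
    simp [evenPowerSum]
  | one => exact hv
  | more k h0 h1 =>
    have ha := biDegreeLE_mono (by omega : 1 + (k + 1) ≤ k + 2) (mul_mem_biDegreeLE hv h1)
    have hb := biDegreeLE_mono (by omega : 2 * 1 + k ≤ k + 2)
      (mul_mem_biDegreeLE (pow_mem_biDegreeLE half_add_mem_biDegreeLE 2) h0)
    exact sub_mem ha hb

/-- The symmetrization of a monomial `s^a t^b` of even degree `2 d` is a function of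
`(2 s t, s² + t² - 1)`, and has degree at most `d` in `x` and in `y` when `(x + y, x y)` is
substituted. -/
lemma exists_symmetrization {a b d : ℕ} (h : a + b = 2 * d) :
    ∃ G : ℝ × ℝ → ℝ, G ∘ symMap ∈ biDegreeLE d ∧
      ∀ s t : ℝ, s ^ a * t ^ b + t ^ a * s ^ b = G (foldMap (s, t)) := by
  wlog hab : a ≤ b generalizing a b
  · obtain ⟨G, hG, hG'⟩ := this (by omega : b + a = 2 * d) (by omega)
    exact ⟨G, hG, fun s t => by rw [← hG']; ring⟩
  obtain ⟨k, rfl⟩ : ∃ k, b = a + 2 * k := ⟨(b - a) / 2, by omega⟩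
  have hd : a * 1 + k = d := by omega
  refine ⟨fun z => (z.1 / 2) ^ a * evenPowerSum k z, ?_, fun s t => ?_⟩
  · rw [← hd]
    exact mul_mem_biDegreeLE (pow_mem_biDegreeLE half_add_mem_biDegreeLE a)
      (evenPowerSum_symMap_mem k)
  · simp only [evenPowerSum_foldMap]
    simp only [foldMap]
    ring

/-! ### The explicit rules as product Gauss rules -/

section Rules

variable {w : ℝ → ℝ} {n : ℕ} {θ : Fin n → ℝ}

/-- The product of two Gauss rules, applied to a function of two variables. -/
def productRule (w : ℝ → ℝ) (θ : Fin n → ℝ) (H : ℝ × ℝ → ℝ) : ℝ :=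
  ∑ k, ∑ j, gaussWeight w θ j * gaussWeight w θ k * H (Real.cos (θ j), Real.cos (θ k))

lemma setIntegral_square_pow_mul_pow (w : ℝ → ℝ) (i j : ℕ) :
    ∫ z in square, z.1 ^ i * z.2 ^ j * (w z.1 * w z.2) =
      (∫ t in Icc (-1 : ℝ) 1, t ^ i * w t) * ∫ t in Icc (-1 : ℝ) 1, t ^ j * w t := by
  rw [square, ← setIntegral_prod_mul]
  simp only [mul_mul_mul_comm]
  rfl

lemma productRule_pow_mul_pow (w : ℝ → ℝ) (θ : Fin n → ℝ) (i j : ℕ) :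
    productRule w θ (fun z => z.1 ^ i * z.2 ^ j) =
      (∑ k, gaussWeight w θ k * Real.cos (θ k) ^ i) *
        ∑ k, gaussWeight w θ k * Real.cos (θ k) ^ j := by
  rw [productRule, Finset.sum_comm, Finset.sum_mul_sum]
  refine Finset.sum_congr rfl fun _ _ => Finset.sum_congr rfl fun _ _ => ?_
  ring

lemma gauss_quadrature_pow (hw_nonneg : ∀ t ∈ Icc (-1 : ℝ) 1, 0 ≤ w t)
    (hw_int : IntegrableOn w (Icc (-1 : ℝ) 1)) (hw_pos : 0 < ∫ t in Icc (-1 : ℝ) 1, w t)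
    (hn : 1 ≤ n) (hθ : IsZeroAngles w n θ) {i : ℕ} (hi : i ≤ 2 * n - 1) :
    ∑ k, gaussWeight w θ k * Real.cos (θ k) ^ i =
      cNorm w * ∫ t in Icc (-1 : ℝ) 1, t ^ i * w t := by
  have := gauss_quadrature hw_nonneg hw_int hw_pos hn hθ (X ^ i) (by simpa using hi)
  simpa using this.symm

lemma productRule_eq (hw_nonneg : ∀ t ∈ Icc (-1 : ℝ) 1, 0 ≤ w t)
    (hw_int : IntegrableOn w (Icc (-1 : ℝ) 1)) (hw_pos : 0 < ∫ t in Icc (-1 : ℝ) 1, w t)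
    (hn : 1 ≤ n) (hθ : IsZeroAngles w n θ) {H : ℝ × ℝ → ℝ} (hH : H ∈ biDegreeLE (2 * n - 1)) :
    productRule w θ H = cNorm w ^ 2 * ∫ z in square, H z * (w z.1 * w z.2) := by
  induction hH using Submodule.span_induction with
  | mem x h =>
    obtain ⟨i, hi, j, hj, rfl⟩ := h
    rw [productRule_pow_mul_pow, setIntegral_square_pow_mul_pow,
      gauss_quadrature_pow hw_nonneg hw_int hw_pos hn hθ hi,
      gauss_quadrature_pow hw_nonneg hw_int hw_pos hn hθ hj]
    ring
  | zero => simp [productRule]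
  | add x y hx hy ihx ihy =>
    have hx' := integrableOn_square_mul_weight hw_int (continuous_of_mem_biDegreeLE hx)
    have hy' := integrableOn_square_mul_weight hw_int (continuous_of_mem_biDegreeLE hy)
    simp only [Pi.add_apply, add_mul]
    rw [integral_add hx' hy', mul_add, ← ihx, ← ihy]
    simp only [productRule, Pi.add_apply, mul_add, Finset.sum_add_distrib]
  | smul a x _ ih =>
    simp only [Pi.smul_apply, smul_eq_mul, mul_assoc]
    rw [integral_const_mul, mul_left_comm, ← ih]
    simp only [productRule, Pi.smul_apply, smul_eq_mul, Finset.mul_sum]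
    refine Finset.sum_congr rfl fun _ _ => Finset.sum_congr rfl fun _ _ => ?_
    ring

lemma Rule.apply_eq_linearCombination (Q : Rule) (f : ℝ × ℝ → ℝ) :
    Q.apply f = Finsupp.linearCombination ℝ f Q := rfl

lemma foldMap_nodes (θ : Fin n → ℝ) (j k : Fin n) :
    foldMap (sNode θ j k, tNode θ j k) = symMap (Real.cos (θ j), Real.cos (θ k)) := by
  have hj : θ j = (θ j + θ k) / 2 + (θ j - θ k) / 2 := by ring
  have hk : θ k = (θ j + θ k) / 2 - (θ j - θ k) / 2 := by ring
  have h1 := Real.sin_sq_add_cos_sq ((θ j + θ k) / 2)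
  have h2 := Real.sin_sq_add_cos_sq ((θ j - θ k) / 2)
  have hcj : Real.cos (θ j) = Real.cos ((θ j + θ k) / 2) * Real.cos ((θ j - θ k) / 2) -
      Real.sin ((θ j + θ k) / 2) * Real.sin ((θ j - θ k) / 2) := by
    rw [← Real.cos_add, ← hj]
  have hck : Real.cos (θ k) = Real.cos ((θ j + θ k) / 2) * Real.cos ((θ j - θ k) / 2) +
      Real.sin ((θ j + θ k) / 2) * Real.sin ((θ j - θ k) / 2) := by
    rw [← Real.cos_sub, ← hk]
  simp only [foldMap, symMap, sNode, tNode]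
  rw [hcj, hck]
  set c := Real.cos ((θ j + θ k) / 2)
  set s := Real.sin ((θ j + θ k) / 2)
  set c' := Real.cos ((θ j - θ k) / 2)
  set s' := Real.sin ((θ j - θ k) / 2)
  ext
  · simp only; ring
  · simp only
    linear_combination s' ^ 2 * h1 + (1 - c ^ 2) * h2

lemma fourPoints_apply {F G : ℝ × ℝ → ℝ}
    (hFG : ∀ s t, F (s, t) + F (t, s) + F (-s, -t) + F (-t, -s) = G (foldMap (s, t)))
    (θ : Fin n → ℝ) (j k : Fin n) :
    Finsupp.linearCombination ℝ F (fourPoints (sNode θ j k) (tNode θ j k)) =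
      G (symMap (Real.cos (θ j), Real.cos (θ k))) := by
  rw [← foldMap_nodes, ← hFG]
  simp [fourPoints]

/-- Summation over the pairs `j ≤ k`, with half weight on the diagonal. -/
lemma sum_Iic_eq_half_sum (A : Fin n → Fin n → ℝ) (hA : ∀ j k, A j k = A k j) :
    ∑ k : Fin n, ∑ j ∈ Finset.Iic k, (if j = k then (1 / 2 : ℝ) else 1) * A j k =
      1 / 2 * ∑ k, ∑ j, A j k := by
  have h1 : ∀ k : Fin n, ∑ j ∈ Finset.Iic k, (if j = k then (1 / 2 : ℝ) else 1) * A j k =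
      ∑ j, (if j < k then 1 else if j = k then 1 / 2 else 0) * A j k := fun k => by
    have : Finset.Iic k = Finset.univ.filter (· ≤ k) := by ext; simp
    rw [this, Finset.sum_filter]
    refine Finset.sum_congr rfl fun j _ => ?_
    rcases lt_trichotomy j k with h | h | h
    · simp [h, h.le, h.ne]
    · simp [h]
    · simp [h.not_ge, h.ne', h.not_gt]
  simp only [h1]
  have h2 := Finset.sum_comm (s := (Finset.univ : Finset (Fin n)))
    (t := (Finset.univ : Finset (Fin n)))
    (f := fun k j => (if j < k then 1 else if j = k then (1 / 2 : ℝ) else 0) * A j k)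
  have h3 : ∑ k, ∑ j, (if j < k then 1 else if j = k then (1 / 2 : ℝ) else 0) * A j k +
      ∑ j, ∑ k, (if j < k then 1 else if j = k then (1 / 2 : ℝ) else 0) * A j k =
      ∑ k, ∑ j, A j k := by
    rw [← Finset.sum_add_distrib]
    refine Finset.sum_congr rfl fun k _ => ?_
    rw [← Finset.sum_add_distrib]
    refine Finset.sum_congr rfl fun j _ => ?_
    rw [hA k j]
    rcases lt_trichotomy j k with h | h | h
    · simp [h, h.ne', h.not_gt]
    · subst h; simp; ring
    · simp [h, h.ne', h.not_gt]
  linarith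

lemma sum_Iio_eq_half_sum (A : Fin n → Fin n → ℝ) (hA : ∀ j k, A j k = A k j)
    (hA0 : ∀ k, A k k = 0) :
    ∑ k : Fin n, ∑ j ∈ Finset.Iio k, A j k = 1 / 2 * ∑ k, ∑ j, A j k := by
  rw [← sum_Iic_eq_half_sum A hA]
  refine Finset.sum_congr rfl fun k _ => ?_
  rw [← Finset.Iio_insert, Finset.sum_insert (by simp), hA0, mul_zero, zero_add]
  refine Finset.sum_congr rfl fun j hj => ?_
  rw [if_neg (Finset.mem_Iio.1 hj).ne, one_mul]

lemma ruleMinus_apply {F G : ℝ × ℝ → ℝ}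
    (hFG : ∀ s t, F (s, t) + F (t, s) + F (-s, -t) + F (-t, -s) = G (foldMap (s, t))) :
    (ruleMinus w θ).apply F = 1 / 4 * productRule w θ (G ∘ symMap) := by
  rw [Rule.apply_eq_linearCombination, ruleMinus]
  simp only [map_smul, map_sum, fourPoints_apply hFG, smul_eq_mul, mul_assoc]
  rw [sum_Iic_eq_half_sum fun j k => gaussWeight w θ k * (gaussWeight w θ j *
    G (symMap (Real.cos (θ j), Real.cos (θ k))))]
  · rw [productRule, ← mul_assoc]
    congr 1
    · norm_num
    · refine Finset.sum_congr rfl fun _ _ => Finset.sum_congr rfl fun _ _ => ?_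
      simp only [Function.comp_apply]
      ring
  · intro j k
    simp only [symMap, add_comm (Real.cos (θ k)), mul_comm (Real.cos (θ k))]
    ring

lemma rulePlus_apply {F G : ℝ × ℝ → ℝ}
    (hFG : ∀ s t, F (s, t) + F (t, s) + F (-s, -t) + F (-t, -s) = G (foldMap (s, t))) :
    (rulePlus w θ).apply F = bNorm w (1 / 2) / (8 * cNorm w ^ 2) *
      productRule w θ (fun z => G (symMap z) * (z.1 - z.2) ^ 2) := by
  rw [Rule.apply_eq_linearCombination, rulePlus]
  simp only [map_smul, map_sum, fourPoints_apply hFG, smul_eq_mul]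
  rw [sum_Iio_eq_half_sum]
  · have : ∀ j k, lambdaPair w θ j k * G (symMap (Real.cos (θ j), Real.cos (θ k))) =
        gaussWeight w θ j * gaussWeight w θ k * (G (symMap (Real.cos (θ j), Real.cos (θ k))) *
          (Real.cos (θ j) - Real.cos (θ k)) ^ 2) := fun j k => by rw [lambdaPair]; ring
    simp only [this, productRule]
    ring
  · intro j k
    simp only [lambdaPair, symMap, add_comm (Real.cos (θ k)), mul_comm (Real.cos (θ k))]
    ring
  · simp [lambdaPair]

end Rules

/-! ### Normalization and positivity -/

section Cubature

variable {w : ℝ → ℝ}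

lemma integral_linearCombination_three {α : Type*} [MeasurableSpace α] {μ : Measure α}
    {f g h : α → ℝ} (hf : Integrable f μ) (hg : Integrable g μ) (hh : Integrable h μ) (a b c : ℝ) :
    ∫ x, (a * f x - b * g x + c * h x) ∂μ =
      a * ∫ x, f x ∂μ - b * ∫ x, g x ∂μ + c * ∫ x, h x ∂μ := by
  simp only [← integral_const_mul]
  rw [← integral_sub (hf.const_mul a) (hg.const_mul b)]
  exact integral_add ((hf.const_mul a).sub (hg.const_mul b)) (hh.const_mul c)

lemma cNorm_pos (hw_pos : 0 < ∫ t in Icc (-1 : ℝ) 1, w t) : 0 < cNorm w := inv_pos.2 hw_pos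

lemma bNorm_eq (hw_int : IntegrableOn w (Icc (-1 : ℝ) 1)) (e : ℕ) :
    bNorm w (e - 1 / 2) =
      (1 / 2 * ∫ z in square, (z.1 - z.2) ^ (2 * e) * (w z.1 * w z.2))⁻¹ := by
  have := (setIntegral_Omega_mul_preWeight hw_int e (G := fun _ => 1) continuous_const).2
  simp only [one_mul] at this
  rw [bNorm, this]

lemma bNorm_zero_eq (hw_int : IntegrableOn w (Icc (-1 : ℝ) 1)) :
    bNorm w ((0 : ℕ) - 1 / 2) = 2 * cNorm w ^ 2 := by
  have := setIntegral_square_pow_mul_pow w 0 0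
  simp only [pow_zero, one_mul] at this
  rw [bNorm_eq hw_int, cNorm]
  simp only [mul_zero, pow_zero, one_mul, this]
  rw [mul_inv, mul_inv]
  ring

/-- The kernel `(x - y)^{2e}` has positive mass for `w(x) w(y)`; for `e = 1` this mass is twice the
variance of `w`, up to normalization. -/
lemma bNorm_pos (hw_nonneg : ∀ t ∈ Icc (-1 : ℝ) 1, 0 ≤ w t)
    (hw_int : IntegrableOn w (Icc (-1 : ℝ) 1)) (hw_pos : 0 < ∫ t in Icc (-1 : ℝ) 1, w t)
    {e : ℕ} (he : e ≤ 1) : 0 < bNorm w (e - 1 / 2) := by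
  interval_cases e
  · rw [bNorm_zero_eq hw_int]
    have := cNorm_pos hw_pos
    positivity
  · rw [bNorm_eq hw_int]
    refine inv_pos.2 (mul_pos (by norm_num) ?_)
    have hI : ∀ i j, IntegrableOn (fun z : ℝ × ℝ => z.1 ^ i * z.2 ^ j * (w z.1 * w z.2)) square :=
      fun i j => integrableOn_square_mul_weight hw_int (by fun_prop)
    have h1 : ∀ z : ℝ × ℝ, (z.1 - z.2) ^ (2 * 1) * (w z.1 * w z.2) =
        1 * (z.1 ^ 2 * z.2 ^ 0 * (w z.1 * w z.2)) - 2 * (z.1 ^ 1 * z.2 ^ 1 * (w z.1 * w z.2)) +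
          1 * (z.1 ^ 0 * z.2 ^ 2 * (w z.1 * w z.2)) := fun z => by ring
    simp only [h1]
    rw [integral_linearCombination_three (hI 2 0) (hI 1 1) (hI 0 2)]
    simp only [setIntegral_square_pow_mul_pow]
    simp only [pow_zero, one_mul, pow_one]
    set m0 := ∫ t in Icc (-1 : ℝ) 1, w t
    set m1 := ∫ t in Icc (-1 : ℝ) 1, t * w t with hm1
    set m2 := ∫ t in Icc (-1 : ℝ) 1, t ^ 2 * w t with hm2
    have h2 := integral_eval_mul_weight_pos hw_nonneg hw_int hw_pos
      (p := (C m0 * X - C m1) ^ 2) (pow_ne_zero 2 fun h => by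
        have := congrArg (fun p : ℝ[X] => p.coeff 1) h
        simp [coeff_C] at this
        exact hw_pos.ne' this) (fun t _ => by simpa using sq_nonneg _)
    have hJ : ∀ i : ℕ, IntegrableOn (fun t : ℝ => t ^ i * w t) (Icc (-1 : ℝ) 1) := fun i =>
      integrableOn_mul_weight hw_int (by fun_prop)
    have h3 : ∀ t : ℝ, ((C m0 * X - C m1 : ℝ[X]) ^ 2).eval t * w t =
        m0 ^ 2 * (t ^ 2 * w t) - 2 * m0 * m1 * (t ^ 1 * w t) + m1 ^ 2 * (t ^ 0 * w t) := fun t => by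
      simp only [eval_pow, eval_sub, eval_mul, eval_C, eval_X]
      ring
    simp only [h3] at h2
    rw [integral_linearCombination_three (hJ 2) (hJ 1) (hJ 0)] at h2
    simp only [pow_one, pow_zero, one_mul] at h2
    rw [← hm1, ← hm2] at h2
    have h4 : 0 < m0 * (m2 * m0 - m1 ^ 2) := by linarith
    have := (pos_iff_pos_of_mul_pos h4).1 hw_pos
    linarith

lemma weightCW_nonneg (hw_nonneg : ∀ t ∈ Icc (-1 : ℝ) 1, 0 ≤ w t) {γ : ℝ} (hb : 0 ≤ bNorm w γ)
    {z : ℝ × ℝ} (hz : z ∈ square) : 0 ≤ weightCW w γ z := by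
  obtain ⟨x, y⟩ := z
  obtain ⟨⟨hx1, hx2⟩, hy1, hy2⟩ := hz
  simp only at hx1 hx2 hy1 hy2
  have hx : 0 ≤ 1 - x ^ 2 := by nlinarith
  have hy : 0 ≤ 1 - y ^ 2 := by nlinarith
  have hdisc : 0 ≤ (2 * x * y) ^ 2 - 4 * (x ^ 2 + y ^ 2 - 1) := by nlinarith [mul_nonneg hx hy]
  have hxy : |x * y| ≤ 1 := by
    rw [abs_mul]
    exact mul_le_one₀ (abs_le.2 ⟨hx1, hx2⟩) (abs_nonneg _) (abs_le.2 ⟨hy1, hy2⟩)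
  rw [abs_le] at hxy
  have h1 : √((2 * x * y) ^ 2 - 4 * (x ^ 2 + y ^ 2 - 1)) ≤ 2 - 2 * x * y :=
    Real.sqrt_le_iff.2 ⟨by linarith, by nlinarith [sq_nonneg (x - y)]⟩
  have h2 : √((2 * x * y) ^ 2 - 4 * (x ^ 2 + y ^ 2 - 1)) ≤ 2 + 2 * x * y :=
    Real.sqrt_le_iff.2 ⟨by linarith, by nlinarith [sq_nonneg (x + y)]⟩
  have h3 := Real.sqrt_nonneg ((2 * x * y) ^ 2 - 4 * (x ^ 2 + y ^ 2 - 1))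
  refine mul_nonneg (mul_nonneg hb (mul_nonneg (mul_nonneg (hw_nonneg _ ⟨?_, ?_⟩)
    (hw_nonneg _ ⟨?_, ?_⟩)) (Real.rpow_nonneg hdisc _))) (abs_nonneg _)
  all_goals simp only; linarith

lemma setIntegral_weightCW (hw_nonneg : ∀ t ∈ Icc (-1 : ℝ) 1, 0 ≤ w t)
    (hw_int : IntegrableOn w (Icc (-1 : ℝ) 1)) (hw_pos : 0 < ∫ t in Icc (-1 : ℝ) 1, w t)
    {e : ℕ} (he : e ≤ 1) : ∫ z in square, weightCW w (e - 1 / 2) z = 1 := by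
  have h := setIntegral_square_mul_weightCW hw_int e (F := fun _ => 1) (G := fun _ => 4)
    continuous_const continuous_const (fun _ _ => by norm_num)
  simp only [one_mul, mul_assoc, integral_const_mul] at h
  have hb := bNorm_pos hw_nonneg hw_int hw_pos he
  rw [h]
  rw [bNorm_eq hw_int] at hb ⊢
  have := (inv_pos.1 hb).ne'
  set I := ∫ z in square, (z.1 - z.2) ^ (2 * e) * (w z.1 * w z.2)
  have hI : I ≠ 0 := right_ne_zero_of_mul this
  field_simp
  norm_num

/-- A polynomial whose square has integral zero for `𝒲_γ` is zero. -/
lemma eq_zero_of_setIntegral_sq_eq_zero (hw_nonneg : ∀ t ∈ Icc (-1 : ℝ) 1, 0 ≤ w t)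
    (hw_int : IntegrableOn w (Icc (-1 : ℝ) 1)) (hw_pos : 0 < ∫ t in Icc (-1 : ℝ) 1, w t)
    {e : ℕ} (he : e ≤ 1) {f : MvPolynomial (Fin 2) ℝ}
    (hf : ∫ z in square, evalAt f z ^ 2 * weightCW w (e - 1 / 2) z = 0) : f = 0 := by
  by_contra hne
  have hb := bNorm_pos hw_nonneg hw_int hw_pos he
  have hsq : MeasurableSet square := measurableSet_Icc.prod measurableSet_Icc
  have h0 : 0 ≤ᵐ[volume.restrict square] fun z => evalAt f z ^ 2 * weightCW w (e - 1 / 2) z :=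
    (ae_restrict_iff' hsq).2
      (.of_forall fun z hz => mul_nonneg (sq_nonneg _) (weightCW_nonneg hw_nonneg hb.le hz))
  have h1 := (integral_eq_zero_iff_of_nonneg_ae h0
    (integrableOn_mul_weightCW hw_int e ((continuous_evalAt f).pow 2))).1 hf
  have h2 : ∀ᵐ z : ℝ × ℝ, evalAt f z ≠ 0 := by
    rw [ae_iff]
    simpa using volume_evalAt_eq_zero hne
  have h3 : weightCW w (e - 1 / 2) =ᵐ[volume.restrict square] 0 := by
    filter_upwards [h1, ae_restrict_of_ae h2] with z hz hz'
    simpa [hz'] using hz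
  have h4 := setIntegral_weightCW hw_nonneg hw_int hw_pos he
  rw [integral_congr_ae h3] at h4
  simp at h4

/-! ### Exactness and degree of the explicit rules -/

variable {n : ℕ} {θ : Fin n → ℝ}

/-- The rule `Q` is obtained by unfolding the product Gauss rule with the kernel `(x - y)^{2e}`:
it depends on `F` only through the sum of `F` over the four symmetries, and this sum, written in
the variables `x + y` and `x y`, is summed over the product grid. -/
def IsUnfoldedProductRule (w : ℝ → ℝ) (θ : Fin n → ℝ) (e : ℕ) (Q : Rule) : Prop :=
  ∀ F G : ℝ × ℝ → ℝ,
    (∀ s t, F (s, t) + F (t, s) + F (-s, -t) + F (-t, -s) = G (foldMap (s, t))) →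
    Q.apply F = bNorm w (e - 1 / 2) / (8 * cNorm w ^ 2) *
      productRule w θ (fun z => G (symMap z) * (z.1 - z.2) ^ (2 * e))

lemma isUnfoldedProductRule_ruleMinus (hw_int : IntegrableOn w (Icc (-1 : ℝ) 1))
    (hw_pos : 0 < ∫ t in Icc (-1 : ℝ) 1, w t) (θ : Fin n → ℝ) :
    IsUnfoldedProductRule w θ 0 (ruleMinus w θ) := fun F G hFG => by
  have := (cNorm_pos hw_pos).ne'
  rw [ruleMinus_apply hFG, bNorm_zero_eq hw_int]
  simp only [mul_zero, pow_zero, mul_one]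
  congr 1
  field_simp
  norm_num

lemma isUnfoldedProductRule_rulePlus (w : ℝ → ℝ) (θ : Fin n → ℝ) :
    IsUnfoldedProductRule w θ 1 (rulePlus w θ) := fun F G hFG => by
  have : ((1 : ℕ) : ℝ) - 1 / 2 = 1 / 2 := by norm_num
  rw [rulePlus_apply hFG, this, mul_one]

lemma sub_pow_mem_biDegreeLE (e : ℕ) : (fun z : ℝ × ℝ => (z.1 - z.2) ^ (2 * e)) ∈
    biDegreeLE (2 * e) := by
  have := pow_mem_biDegreeLE (sub_mem fst_mem_biDegreeLE snd_mem_biDegreeLE) (2 * e)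
  rw [mul_one] at this
  exact this

lemma evalAt_eq_sum (f : MvPolynomial (Fin 2) ℝ) (z : ℝ × ℝ) :
    evalAt f z = ∑ d ∈ f.support, f.coeff d * (z.1 ^ d 0 * z.2 ^ d 1) := by
  rw [evalAt, MvPolynomial.eval_eq']
  simp [Fin.prod_univ_two]

/-- Exactness on monomials: those of odd degree are annihilated on both sides, and for those of even
degree `2d` the integrand has degree at most `d + 2e` in each of the variables. -/
lemma setIntegral_monomial_eq_apply (hw_nonneg : ∀ t ∈ Icc (-1 : ℝ) 1, 0 ≤ w t)
    (hw_int : IntegrableOn w (Icc (-1 : ℝ) 1)) (hw_pos : 0 < ∫ t in Icc (-1 : ℝ) 1, w t)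
    (hn : 1 ≤ n) (hθ : IsZeroAngles w n θ) {e : ℕ} {Q : Rule} (hQ : IsUnfoldedProductRule w θ e Q)
    {a b : ℕ} (hab : a + b + 4 * e + 1 ≤ 4 * n) :
    ∫ z in square, z.1 ^ a * z.2 ^ b * weightCW w (e - 1 / 2) z =
      Q.apply (fun z => z.1 ^ a * z.2 ^ b) := by
  have hc := (cNorm_pos hw_pos).ne'
  obtain ⟨G, d, hd, hG, hFG⟩ : ∃ (G : ℝ × ℝ → ℝ) (d : ℕ), d + 2 * e ≤ 2 * n - 1 ∧
      G ∘ symMap ∈ biDegreeLE d ∧ ∀ s t : ℝ, s ^ a * t ^ b + t ^ a * s ^ b +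
        (-s) ^ a * (-t) ^ b + (-t) ^ a * (-s) ^ b = G (foldMap (s, t)) := by
    rcases Nat.even_or_odd (a + b) with h | h
    · obtain ⟨d, hd⟩ := even_iff_exists_two_mul.1 h
      obtain ⟨G, hG, hG'⟩ := exists_symmetrization hd
      refine ⟨fun z => 2 * G z, d, by omega, (biDegreeLE d).smul_mem 2 hG, fun s t => ?_⟩
      have hs : ∀ s t : ℝ, (-s) ^ a * (-t) ^ b = s ^ a * t ^ b := fun s t => by
        rw [neg_pow, neg_pow t, mul_mul_mul_comm, ← pow_add, h.neg_one_pow, one_mul]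
      rw [hs, hs]
      linear_combination 2 * hG' s t
    · refine ⟨0, 0, by omega, zero_mem _, fun s t => ?_⟩
      have hs : ∀ s t : ℝ, (-s) ^ a * (-t) ^ b = -(s ^ a * t ^ b) := fun s t => by
        rw [neg_pow, neg_pow t, mul_mul_mul_comm, ← pow_add, h.neg_one_pow, neg_one_mul]
      rw [hs, hs]
      simp
  have hmem : (fun z => G (symMap z) * (z.1 - z.2) ^ (2 * e)) ∈ biDegreeLE (2 * n - 1) :=
    biDegreeLE_mono hd (mul_mem_biDegreeLE hG (sub_pow_mem_biDegreeLE e))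
  rw [hQ _ G hFG, productRule_eq hw_nonneg hw_int hw_pos hn hθ hmem,
    setIntegral_square_mul_weightCW hw_int e (by fun_prop) (continuous_of_mem_biDegreeLE hG) hFG]
  field_simp

lemma isExact_of_isUnfoldedProductRule (hw_nonneg : ∀ t ∈ Icc (-1 : ℝ) 1, 0 ≤ w t)
    (hw_int : IntegrableOn w (Icc (-1 : ℝ) 1)) (hw_pos : 0 < ∫ t in Icc (-1 : ℝ) 1, w t)
    (hn : 1 ≤ n) (hθ : IsZeroAngles w n θ) {e : ℕ} {Q : Rule} (hQ : IsUnfoldedProductRule w θ e Q)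
    {m : ℕ} (hm : m + 4 * e + 1 ≤ 4 * n) :
    IsExact square (weightCW w (e - 1 / 2)) m Q := by
  refine fun f hf => ⟨integrableOn_mul_weightCW hw_int e (continuous_evalAt f), ?_⟩
  have h1 : ∀ z, evalAt f z * weightCW w (e - 1 / 2) z =
      ∑ d ∈ f.support, f.coeff d * (z.1 ^ d 0 * z.2 ^ d 1 * weightCW w (e - 1 / 2) z) := fun z => by
    rw [evalAt_eq_sum, Finset.sum_mul]
    simp only [mul_assoc]
  have h2 : Q.apply (evalAt f) =
      ∑ d ∈ f.support, f.coeff d * Q.apply (fun z => z.1 ^ d 0 * z.2 ^ d 1) := by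
    simp only [Rule.apply, Finsupp.sum, evalAt_eq_sum, Finset.mul_sum]
    rw [Finset.sum_comm]
    refine Finset.sum_congr rfl fun _ _ => Finset.sum_congr rfl fun _ _ => ?_
    ring
  simp only [h1]
  rw [h2, integral_finsetSum _ fun d _ =>
    (integrableOn_mul_weightCW hw_int e (F := fun z => z.1 ^ d 0 * z.2 ^ d 1)
      (by fun_prop)).const_mul _]
  refine Finset.sum_congr rfl fun d hd => ?_
  have hdeg := (MvPolynomial.le_totalDegree hd).trans hf
  rw [Finsupp.sum_fintype _ _ fun _ => rfl, Fin.sum_univ_two] at hdeg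
  rw [integral_const_mul, setIntegral_monomial_eq_apply hw_nonneg hw_int hw_pos hn hθ hQ (by omega)]

/-- `λ_k` is the integral of `l_k²`. -/
lemma gaussWeight_nonneg (hw_nonneg : ∀ t ∈ Icc (-1 : ℝ) 1, 0 ≤ w t)
    (hw_int : IntegrableOn w (Icc (-1 : ℝ) 1)) (hw_pos : 0 < ∫ t in Icc (-1 : ℝ) 1, w t)
    (hn : 1 ≤ n) (hθ : IsZeroAngles w n θ) (k : Fin n) : 0 ≤ gaussWeight w θ k := by
  set v : Fin n → ℝ := fun j => Real.cos (θ j)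
  set l := Lagrange.basis Finset.univ v k with hl
  have hv : InjOn v (Finset.univ : Finset (Fin n)) := hθ.cos_injective.injOn
  have hdeg : (l ^ 2).natDegree ≤ 2 * n - 1 := by
    rw [natDegree_pow, hl, Lagrange.natDegree_basis hv (Finset.mem_univ k), Finset.card_univ,
      Fintype.card_fin]
    omega
  have h := gauss_quadrature hw_nonneg hw_int hw_pos hn hθ (l ^ 2) hdeg
  rw [Finset.sum_eq_single k] at h
  · have h1 : l.eval (Real.cos (θ k)) = 1 := Lagrange.eval_basis_self hv (Finset.mem_univ k)
    rw [eval_pow, h1, one_pow, mul_one] at h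
    rw [← h]
    refine mul_nonneg (cNorm_pos hw_pos).le (setIntegral_nonneg measurableSet_Icc fun t ht => ?_)
    rw [eval_pow]
    exact mul_nonneg (sq_nonneg _) (hw_nonneg t ht)
  · intro j _ hj
    have h1 : l.eval (Real.cos (θ j)) = 0 :=
      Lagrange.eval_basis_of_ne (v := v) hj.symm (Finset.mem_univ j)
    simp [h1]
  · simp

/-- The Gauss rule underestimates the moment of order `2n`, by the squared norm of `p_n`. -/
lemma gauss_lt_moment (hw_nonneg : ∀ t ∈ Icc (-1 : ℝ) 1, 0 ≤ w t)
    (hw_int : IntegrableOn w (Icc (-1 : ℝ) 1)) (hw_pos : 0 < ∫ t in Icc (-1 : ℝ) 1, w t)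
    (hn : 1 ≤ n) (hθ : IsZeroAngles w n θ) :
    ∑ k, gaussWeight w θ k * Real.cos (θ k) ^ (2 * n) <
      cNorm w * ∫ t in Icc (-1 : ℝ) 1, t ^ (2 * n) * w t := by
  set p := orthoPoly w n with hp
  have hm : (p ^ 2).Monic := (orthoPoly_monic w n).pow 2
  have hdeg : (X ^ (2 * n) - p ^ 2 : ℝ[X]).natDegree ≤ 2 * n - 1 := by
    have hpd : (p ^ 2).natDegree = 2 * n := by rw [natDegree_pow, hp, natDegree_orthoPoly]
    have hlt : (X ^ (2 * n) - p ^ 2 : ℝ[X]).degree < ((2 * n : ℕ) : WithBot ℕ) := by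
      have := degree_sub_lt_left (p := (X ^ (2 * n) : ℝ[X])) (q := p ^ 2) ?_ (by simp) ?_
      · rwa [degree_X_pow] at this
      · rw [degree_X_pow, degree_eq_natDegree hm.ne_zero, hpd]
      · rw [hm.leadingCoeff, (monic_X_pow _).leadingCoeff]
    by_cases h0 : (X ^ (2 * n) - p ^ 2 : ℝ[X]) = 0
    · simp [h0]
    · have := (natDegree_lt_iff_degree_lt h0).2 hlt
      omega
  have h := gauss_quadrature hw_nonneg hw_int hw_pos hn hθ _ hdeg
  have hroot : ∀ k, p.eval (Real.cos (θ k)) = 0 := fun k => (hθ.2 k).2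
  simp only [eval_sub, eval_pow, eval_X, hroot] at h
  have hsplit : ∫ t in Icc (-1 : ℝ) 1, (t ^ (2 * n) - p.eval t ^ 2) * w t =
      (∫ t in Icc (-1 : ℝ) 1, t ^ (2 * n) * w t) - ∫ t in Icc (-1 : ℝ) 1, (p ^ 2).eval t * w t := by
    rw [← integral_sub (integrableOn_mul_weight hw_int (by fun_prop))
      (integrableOn_eval_mul_weight hw_int _)]
    simp only [eval_pow, sub_mul]
  have hpos := integral_eval_mul_weight_pos hw_nonneg hw_int hw_pos hm.ne_zero
    fun t _ => by simpa using sq_nonneg (p.eval t)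
  rw [hsplit] at h
  have := mul_pos (cNorm_pos hw_pos) hpos
  simp only [ne_eq, OfNat.ofNat_ne_zero, not_false_eq_true, zero_pow, sub_zero] at h
  rw [← h]
  linarith

lemma moment_pos (hw_nonneg : ∀ t ∈ Icc (-1 : ℝ) 1, 0 ≤ w t)
    (hw_int : IntegrableOn w (Icc (-1 : ℝ) 1)) (hw_pos : 0 < ∫ t in Icc (-1 : ℝ) 1, w t) {i : ℕ}
    (hi : Even i) : 0 < ∫ t in Icc (-1 : ℝ) 1, t ^ i * w t := by
  have := integral_eval_mul_weight_pos hw_nonneg hw_int hw_pos (p := X ^ i) (by simp)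
    fun t _ => by simpa using hi.pow_nonneg t
  simpa using this

/-- The product Gauss rule fails for `(x y)^{2n-2e} (x - y)^{2e}`, whose only monomials of degree
beyond its reach are those containing `x^{2n}` or `y^{2n}`. -/
lemma productRule_ne (hw_nonneg : ∀ t ∈ Icc (-1 : ℝ) 1, 0 ≤ w t)
    (hw_int : IntegrableOn w (Icc (-1 : ℝ) 1)) (hw_pos : 0 < ∫ t in Icc (-1 : ℝ) 1, w t)
    (hn : 1 ≤ n) (hθ : IsZeroAngles w n θ) {e : ℕ} (he : e ≤ 1) :
    cNorm w ^ 2 * ∫ z in square, (z.1 * z.2) ^ (2 * n - 2 * e) * (z.1 - z.2) ^ (2 * e) *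
      (w z.1 * w z.2) ≠
      productRule w θ (fun z => (z.1 * z.2) ^ (2 * n - 2 * e) * (z.1 - z.2) ^ (2 * e)) := by
  have hlt := gauss_lt_moment hw_nonneg hw_int hw_pos hn hθ
  have hc := cNorm_pos hw_pos
  have hS : 0 ≤ ∑ k, gaussWeight w θ k * Real.cos (θ k) ^ (2 * n) :=
    Finset.sum_nonneg fun k _ => mul_nonneg (gaussWeight_nonneg hw_nonneg hw_int hw_pos hn hθ k)
      ((even_two_mul n).pow_nonneg _)
  interval_cases e
  · have h1 := setIntegral_square_pow_mul_pow w (2 * n) (2 * n)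
    have h2 := productRule_pow_mul_pow w θ (2 * n) (2 * n)
    simp only [mul_zero, Nat.sub_zero, pow_zero, mul_one, mul_pow] at h1 h2 ⊢
    rw [h1, h2]
    refine ne_of_gt ((mul_self_lt_mul_self hS hlt).trans_eq ?_)
    ring
  · obtain ⟨m, hm⟩ : ∃ m, 2 * n = m + 2 := ⟨2 * n - 2, by omega⟩
    have hme : Even m := by
      rw [Nat.even_iff]; omega
    have hI : ∀ i j, IntegrableOn (fun z : ℝ × ℝ => z.1 ^ i * z.2 ^ j * (w z.1 * w z.2)) square :=
      fun i j => integrableOn_square_mul_weight hw_int (by fun_prop)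
    have hH : ∀ z : ℝ × ℝ, (z.1 * z.2) ^ (2 * n - 2 * 1) * (z.1 - z.2) ^ (2 * 1) =
        z.1 ^ (m + 2) * z.2 ^ m - 2 * (z.1 ^ (m + 1) * z.2 ^ (m + 1)) +
          z.1 ^ m * z.2 ^ (m + 2) := by
      intro z
      rw [hm, mul_one, Nat.add_sub_cancel]
      ring
    have h1 : ∫ z in square, (z.1 * z.2) ^ (2 * n - 2 * 1) * (z.1 - z.2) ^ (2 * 1) *
        (w z.1 * w z.2) = (∫ z in square, z.1 ^ (m + 2) * z.2 ^ m * (w z.1 * w z.2)) -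
        2 * (∫ z in square, z.1 ^ (m + 1) * z.2 ^ (m + 1) * (w z.1 * w z.2)) +
        ∫ z in square, z.1 ^ m * z.2 ^ (m + 2) * (w z.1 * w z.2) := by
      have h := integral_linearCombination_three (hI (m + 2) m) (hI (m + 1) (m + 1))
        (hI m (m + 2)) 1 2 1
      rw [one_mul, one_mul] at h
      rw [← h]
      congr 1 with z
      rw [hH]
      ring
    have h2 : productRule w θ (fun z => (z.1 * z.2) ^ (2 * n - 2 * 1) * (z.1 - z.2) ^ (2 * 1)) =
        productRule w θ (fun z => z.1 ^ (m + 2) * z.2 ^ m) -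
        2 * productRule w θ (fun z => z.1 ^ (m + 1) * z.2 ^ (m + 1)) +
        productRule w θ (fun z => z.1 ^ m * z.2 ^ (m + 2)) := by
      rw [funext hH]
      simp only [productRule, Finset.mul_sum, ← Finset.sum_sub_distrib, ← Finset.sum_add_distrib]
      refine Finset.sum_congr rfl fun _ _ => Finset.sum_congr rfl fun _ _ => ?_
      ring
    rw [h1, h2]
    simp only [productRule_pow_mul_pow, setIntegral_square_pow_mul_pow]
    rw [gauss_quadrature_pow hw_nonneg hw_int hw_pos hn hθ (i := m) (by omega),
      gauss_quadrature_pow hw_nonneg hw_int hw_pos hn hθ (i := m + 1) (by omega)]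
    rw [hm] at hlt
    have hmom := mul_pos hc (moment_pos hw_nonneg hw_int hw_pos hme)
    have := mul_pos (sub_pos.2 hlt) hmom
    refine ne_of_gt ?_
    linarith

lemma hasDegree_of_isUnfoldedProductRule (hw_nonneg : ∀ t ∈ Icc (-1 : ℝ) 1, 0 ≤ w t)
    (hw_int : IntegrableOn w (Icc (-1 : ℝ) 1)) (hw_pos : 0 < ∫ t in Icc (-1 : ℝ) 1, w t)
    (hn : 1 ≤ n) (hθ : IsZeroAngles w n θ) {e : ℕ} (he : e ≤ 1) {Q : Rule}
    (hQ : IsUnfoldedProductRule w θ e Q) {m : ℕ} (hm : m + 4 * e + 1 = 4 * n) :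
    HasDegree square (weightCW w (e - 1 / 2)) m Q := by
  refine ⟨isExact_of_isUnfoldedProductRule hw_nonneg hw_int hw_pos hn hθ hQ hm.le, ?_⟩
  let f : MvPolynomial (Fin 2) ℝ := (.X 0 ^ 2 + .X 1 ^ 2 - 1) ^ (2 * n - 2 * e)
  have hf : ∀ z, evalAt f z = (z.1 ^ 2 + z.2 ^ 2 - 1) ^ (2 * n - 2 * e) := fun z => by
    simp [f, evalAt]
  refine ⟨f, ?_, integrableOn_mul_weightCW hw_int e (continuous_evalAt f), fun h => ?_⟩
  · have h2 : (.X 0 ^ 2 + .X 1 ^ 2 - 1 : MvPolynomial (Fin 2) ℝ).totalDegree ≤ 2 := by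
      refine (MvPolynomial.totalDegree_sub _ _).trans (max_le
        ((MvPolynomial.totalDegree_add _ _).trans (max_le ?_ ?_)) ?_)
      · exact (MvPolynomial.totalDegree_X_pow _ _).le
      · exact (MvPolynomial.totalDegree_X_pow _ _).le
      · simp
    refine (MvPolynomial.totalDegree_pow _ _).trans ((Nat.mul_le_mul_left _ h2).trans ?_)
    omega
  · have hFG : ∀ s t, evalAt f (s, t) + evalAt f (t, s) + evalAt f (-s, -t) + evalAt f (-t, -s) =
        (fun z : ℝ × ℝ => 4 * z.2 ^ (2 * n - 2 * e)) (foldMap (s, t)) := fun s t => by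
      simp only [hf, foldMap, neg_sq, add_comm (t ^ 2)]
      ring
    -- the symmetrization of `f` is four times a power of `x y`
    rw [hQ _ (fun z => 4 * z.2 ^ (2 * n - 2 * e)) hFG, setIntegral_square_mul_weightCW hw_int e
      (G := fun z => 4 * z.2 ^ (2 * n - 2 * e)) (continuous_evalAt f)
      (by simp only [symMap]; fun_prop) hFG] at h
    have hb := bNorm_pos hw_nonneg hw_int hw_pos he
    have hc := cNorm_pos hw_pos
    refine productRule_ne hw_nonneg hw_int hw_pos hn hθ he ?_
    have h3 : productRule w θ (fun z => 4 * (symMap z).2 ^ (2 * n - 2 * e) *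
        (z.1 - z.2) ^ (2 * e)) = 4 * productRule w θ
          (fun z => (z.1 * z.2) ^ (2 * n - 2 * e) * (z.1 - z.2) ^ (2 * e)) := by
      simp only [productRule, symMap, Finset.mul_sum]
      refine Finset.sum_congr rfl fun _ _ => Finset.sum_congr rfl fun _ _ => ?_
      ring
    simp only [mul_assoc] at h h3 ⊢
    rw [h3, integral_const_mul] at h
    simp only [symMap] at h
    generalize ∫ z in square, (z.1 * z.2) ^ (2 * n - 2 * e) *
      ((z.1 - z.2) ^ (2 * e) * (w z.1 * w z.2)) = I at h ⊢
    generalize productRule w θ (fun z => (z.1 * z.2) ^ (2 * n - 2 * e) *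
      (z.1 - z.2) ^ (2 * e)) = P at h ⊢
    generalize bNorm w (e - 1 / 2) = b at h hb
    field_simp at h
    linarith

end Cubature

/-! ### Möller's lower bound -/

lemma evalAt_mul (f g : MvPolynomial (Fin 2) ℝ) (z : ℝ × ℝ) :
    evalAt (f * g) z = evalAt f z * evalAt g z := by simp [evalAt]

lemma Rule.apply_eq_sum (Q : Rule) (F : ℝ × ℝ → ℝ) :
    Q.apply F = ∑ z : Q.support, Q z * F z := by
  rw [Rule.apply, Finsupp.sum, Finset.sum_coe_sort Q.support fun z => Q z * F z]

/-- The exponents `(a, b)` with `a + b ≤ 2k - 1` odd: the index `(i, j)` stands for `a = j`,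
`b = 2 i + 1 - j`. -/
abbrev OddIndex (k : ℕ) : Type := (i : Fin k) × Fin (2 * (i : ℕ) + 2)

lemma card_oddIndex (k : ℕ) : Fintype.card (OddIndex k) = k * (k + 1) := by
  simp only [Fintype.card_sigma, Fintype.card_fin]
  rw [Fin.sum_univ_eq_sum_range fun i => 2 * i + 2]
  induction k with
  | zero => rfl
  | succ k ih => rw [Finset.sum_range_succ, ih]; ring

/-- The exponent vector of an index in `OddIndex k`. -/
def oddExponent {k : ℕ} (p : OddIndex k) : Fin 2 →₀ ℕ :=
  Finsupp.equivFunOnFinite.symm ![(p.2 : ℕ), 2 * (p.1 : ℕ) + 1 - (p.2 : ℕ)]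

lemma oddExponent_zero {k : ℕ} (p : OddIndex k) : oddExponent p 0 = (p.2 : ℕ) := rfl

lemma oddExponent_one {k : ℕ} (p : OddIndex k) :
    oddExponent p 1 = 2 * (p.1 : ℕ) + 1 - (p.2 : ℕ) := rfl

lemma oddExponent_injective (k : ℕ) : Function.Injective (oddExponent (k := k)) := by
  rintro ⟨i, j⟩ ⟨i', j'⟩ h
  have h0 := congrArg (fun d => d 0) h
  have h1 := congrArg (fun d => d 1) h
  simp only [oddExponent_zero, oddExponent_one] at h0 h1
  have hj := j.2
  have hj' := j'.2
  obtain rfl : i = i' := Fin.ext (by omega)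
  obtain rfl : j = j' := Fin.ext h0
  rfl

/-- The odd polynomial of degree at most `2k - 1` with given coefficients. -/
def oddPoly (k : ℕ) : (OddIndex k → ℝ) →ₗ[ℝ] MvPolynomial (Fin 2) ℝ :=
  Fintype.linearCombination ℝ fun p => MvPolynomial.monomial (oddExponent p) 1

lemma oddPoly_injective (k : ℕ) : Function.Injective (oddPoly k) :=
  LinearIndependent.fintypeLinearCombination_injective
    ((MvPolynomial.basisMonomials (Fin 2) ℝ).linearIndependent.comp _ (oddExponent_injective k))

lemma totalDegree_oddPoly_le (k : ℕ) (c : OddIndex k → ℝ) :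
    (oddPoly k c).totalDegree ≤ 2 * k - 1 := by
  rw [oddPoly, Fintype.linearCombination_apply]
  refine MvPolynomial.totalDegree_finsetSum_le fun p _ => ?_
  refine (MvPolynomial.totalDegree_smul_le _ _).trans
    ((MvPolynomial.totalDegree_monomial_le _ _).trans ?_)
  rw [Finsupp.sum_fintype _ _ fun _ => rfl, Fin.sum_univ_two, oddExponent_zero, oddExponent_one]
  have h1 := p.1.2
  have h2 := p.2.2
  simp only [id_eq]
  omega

lemma evalAt_oddPoly_neg (k : ℕ) (c : OddIndex k → ℝ) (z : ℝ × ℝ) :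
    evalAt (oddPoly k c) (-z.1, -z.2) = -evalAt (oddPoly k c) z := by
  simp only [evalAt, oddPoly, Fintype.linearCombination_apply, map_sum, MvPolynomial.smul_eval,
    MvPolynomial.eval_monomial, one_mul, ← Finset.sum_neg_distrib]
  refine Finset.sum_congr rfl fun p _ => ?_
  simp only [Finsupp.prod_fintype _ _ fun _ => pow_zero _, Fin.prod_univ_two, oddExponent_zero,
    oddExponent_one, Matrix.cons_val_zero, Matrix.cons_val_one]
  have hodd : Odd ((p.2 : ℕ) + (2 * (p.1 : ℕ) + 1 - (p.2 : ℕ))) := by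
    have h2 := p.2.2
    exact ⟨p.1, by omega⟩
  rw [neg_pow, neg_pow z.2, mul_mul_mul_comm, ← pow_add, hodd.neg_one_pow]
  ring

/-- A linear form that vanishes at none of finitely many points other than the origin. -/
lemma exists_linearForm_ne_zero (S : Finset (ℝ × ℝ)) :
    ∃ a : ℝ, ∀ z ∈ S, z.1 + a * z.2 = 0 → z = 0 := by
  obtain ⟨a, ha⟩ := Infinite.exists_notMem_finset (S.image fun z => -z.1 / z.2)
  refine ⟨a, fun z hz h => ?_⟩
  by_cases h2 : z.2 = 0
  · rw [h2, mul_zero, add_zero] at h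
    exact Prod.ext h h2
  · refine absurd (Finset.mem_image.2 ⟨z, hz, ?_⟩) ha
    rw [div_eq_iff h2]
    linarith

/-- Möller's bound. Let `ℓ` be a linear form that vanishes at no node besides the origin. The
values at the nodes of the odd polynomials `f`, and the values of the products `c ℓ g` with `c` the
cubature weights and `g` odd, form two spaces of dimension `k (k + 1)`. They are orthogonal, because
the rule annihilates the odd polynomials `ℓ f g`; hence their dimensions add up to at most the
number of nodes. -/
lemma two_mul_le_numNodes (Q : Rule) {k : ℕ} (hk : 1 ≤ k)
    (hpos : ∀ f : MvPolynomial (Fin 2) ℝ, f.totalDegree ≤ 2 * k - 1 →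
      Q.apply (fun z => evalAt f z ^ 2) = 0 → f = 0)
    (hodd : ∀ f : MvPolynomial (Fin 2) ℝ, f.totalDegree ≤ 4 * k - 1 →
      (∀ z : ℝ × ℝ, evalAt f (-z.1, -z.2) = -evalAt f z) → Q.apply (evalAt f) = 0) :
    2 * (k * (k + 1)) ≤ Q.numNodes := by
  obtain ⟨a, ha⟩ := exists_linearForm_ne_zero Q.support
  let evalNodes : (OddIndex k → ℝ) →ₗ[ℝ] (Q.support → ℝ) :=
    { toFun := fun c z => evalAt (oddPoly k c) z
      map_add' := fun c d => by ext z; simp [evalAt]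
      map_smul' := fun r c => by ext z; simp [evalAt] }
  let scale : (Q.support → ℝ) →ₗ[ℝ] (Q.support → ℝ) :=
    { toFun := fun v z => Q z * (z.1.1 + a * z.1.2) * v z
      map_add' := fun u v => by ext z; simp only [Pi.add_apply]; ring
      map_smul' := fun r v => by
        ext z
        simp only [Pi.smul_apply, smul_eq_mul, RingHom.id_apply]
        ring }
  -- the rule annihilates the square of a polynomial that vanishes at all nodes
  have hinj : Function.Injective evalNodes := by
    rw [injective_iff_map_eq_zero]
    intro c hc
    refine (injective_iff_map_eq_zero _).1 (oddPoly_injective k) c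
      (hpos _ (totalDegree_oddPoly_le k c) ?_)
    rw [Rule.apply_eq_sum]
    refine Finset.sum_eq_zero fun z _ => ?_
    have : evalAt (oddPoly k c) z = 0 := congrFun hc z
    rw [this]
    ring
  -- `scale` may vanish at the origin, but so do the odd polynomials
  have hinj' : Function.Injective (scale ∘ₗ evalNodes) := by
    rw [injective_iff_map_eq_zero]
    intro c hc
    refine (injective_iff_map_eq_zero _).1 hinj c (funext fun z => ?_)
    have hz : Q z * (z.1.1 + a * z.1.2) * evalAt (oddPoly k c) z = 0 := congrFun hc z
    rcases mul_eq_zero.1 hz with h | h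
    · have hz0 : (z : ℝ × ℝ) = 0 :=
        ha z z.2 ((mul_eq_zero.1 h).resolve_left (Finsupp.mem_support_iff.1 z.2))
      have hneg := evalAt_oddPoly_neg k c z
      change evalAt (oddPoly k c) z = 0
      rw [hz0] at hneg ⊢
      simp only [Prod.fst_zero, Prod.snd_zero, neg_zero] at hneg
      have : ((0 : ℝ), (0 : ℝ)) = 0 := rfl
      rw [this] at hneg
      linarith
    · exact h
  have horth : ∀ c d, ∑ z, evalNodes c z * scale (evalNodes d) z = 0 := by
    intro c d
    let l : MvPolynomial (Fin 2) ℝ := .X 0 + .C a * .X 1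
    have hl : ∀ z, evalAt l z = z.1 + a * z.2 := fun z => by simp [l, evalAt]
    have hldeg : l.totalDegree ≤ 1 := by
      refine (MvPolynomial.totalDegree_add _ _).trans (max_le ?_ ?_)
      · exact (MvPolynomial.totalDegree_X _).le
      · refine (MvPolynomial.totalDegree_mul _ _).trans ?_
        rw [MvPolynomial.totalDegree_C, MvPolynomial.totalDegree_X]
    have hdeg : (l * (oddPoly k c * oddPoly k d)).totalDegree ≤ 4 * k - 1 := by
      have h1 := MvPolynomial.totalDegree_mul l (oddPoly k c * oddPoly k d)
      have h2 := MvPolynomial.totalDegree_mul (oddPoly k c) (oddPoly k d)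
      have h3 := totalDegree_oddPoly_le k c
      have h4 := totalDegree_oddPoly_le k d
      omega
    have h := hodd _ hdeg fun z => by
      simp only [evalAt_mul, evalAt_oddPoly_neg, hl]
      ring
    rw [Rule.apply_eq_sum] at h
    rw [← h]
    refine Finset.sum_congr rfl fun z _ => ?_
    simp only [evalAt_mul, hl]
    change evalAt (oddPoly k c) z * (Q z * (z.1.1 + a * z.1.2) * evalAt (oddPoly k d) z) = _
    ring
  have hdisj : Disjoint (LinearMap.range evalNodes) (LinearMap.range (scale ∘ₗ evalNodes)) := by
    rw [Submodule.disjoint_def]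
    rintro v ⟨c, rfl⟩ ⟨d, hd⟩
    have h := horth c d
    change (scale (evalNodes d)) = _ at hd
    rw [hd] at h
    ext z
    have := (Finset.sum_eq_zero_iff_of_nonneg fun z _ => mul_self_nonneg (evalNodes c z)).1 h z
      (Finset.mem_univ z)
    exact mul_self_eq_zero.1 this
  have h := Submodule.finrank_add_finrank_le_of_disjoint hdisj
  rw [LinearMap.finrank_range_of_inj hinj, LinearMap.finrank_range_of_inj hinj',
    Module.finrank_fintype_fun_eq_card, Module.finrank_fintype_fun_eq_card, card_oddIndex,
    Fintype.card_coe] at h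
  rw [Rule.numNodes]
  omega

lemma two_mul_le_numNodes_of_isExact {w : ℝ → ℝ} (hw_nonneg : ∀ t ∈ Icc (-1 : ℝ) 1, 0 ≤ w t)
    (hw_int : IntegrableOn w (Icc (-1 : ℝ) 1)) (hw_pos : 0 < ∫ t in Icc (-1 : ℝ) 1, w t)
    {e : ℕ} (he : e ≤ 1) {k : ℕ} (hk : 1 ≤ k) {Q : Rule}
    (hQ : IsExact square (weightCW w (e - 1 / 2)) (4 * k - 1) Q) :
    2 * (k * (k + 1)) ≤ Q.numNodes := by
  refine two_mul_le_numNodes Q hk (fun f hf h => ?_) fun f hf hneg => ?_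
  · refine eq_zero_of_setIntegral_sq_eq_zero hw_nonneg hw_int hw_pos he ?_
    have hdeg : (f * f).totalDegree ≤ 4 * k - 1 := by
      have := MvPolynomial.totalDegree_mul f f
      omega
    have h1 := (hQ (f * f) hdeg).2
    have h2 : evalAt (f * f) = fun z => evalAt f z ^ 2 := by
      ext z
      rw [evalAt_mul, sq]
    rw [h2, h] at h1
    exact h1
  · rw [← (hQ f hf).2, setIntegral_square_mul_weightCW hw_int e (G := fun _ => 0)
      (continuous_evalAt f) continuous_const]
    · simp
    · intro s t
      have h1 := hneg (s, t)
      have h2 := hneg (t, s)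
      simp only at h1 h2
      rw [h1, h2]
      ring

/-! ### Counting the nodes -/

lemma dimPi_eq_sum (m : ℕ) : dimPi m = ∑ i ∈ Finset.range (m + 1), (i + 1) := by
  rw [dimPi, MvPolynomial.restrictTotalDegree,
    Module.finrank_eq_nat_card_basis (MvPolynomial.basisRestrictSupport ℝ _)]
  have hbij : Function.Bijective (fun p : (i : Fin (m + 1)) × Fin ((i : ℕ) + 1) =>
      (⟨Finsupp.equivFunOnFinite.symm ![(p.2 : ℕ), (p.1 : ℕ) - (p.2 : ℕ)], by
        have h1 := p.1.2
        have h2 := p.2.2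
        rw [mem_ofPred_eq, Finsupp.sum_fintype _ _ fun _ => rfl, Fin.sum_univ_two]
        simp only [Finsupp.equivFunOnFinite_symm_apply_apply, Matrix.cons_val_zero,
          Matrix.cons_val_one]
        omega⟩ : {d : Fin 2 →₀ ℕ | (d.sum fun _ e => e) ≤ m})) := by
    constructor
    · rintro ⟨i, j⟩ ⟨i', j'⟩ h
      have h' := congrArg Subtype.val h
      have h0 : (j : ℕ) = j' := congrArg (fun d : Fin 2 →₀ ℕ => d 0) h'
      have h1 : (i : ℕ) - j = i' - j' := congrArg (fun d : Fin 2 →₀ ℕ => d 1) h'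
      have hj := j.2
      have hj' := j'.2
      obtain rfl : i = i' := Fin.ext (by omega)
      obtain rfl : j = j' := Fin.ext h0
      rfl
    · rintro ⟨d, hd⟩
      rw [mem_ofPred_eq, Finsupp.sum_fintype _ _ fun _ => rfl, Fin.sum_univ_two] at hd
      refine ⟨⟨⟨d 0 + d 1, by omega⟩, ⟨d 0, by simp only; omega⟩⟩, Subtype.ext ?_⟩
      ext i
      fin_cases i
      · rfl
      · exact Nat.add_sub_cancel_left (d 0) (d 1)
  rw [← Nat.card_eq_of_bijective _ hbij, Nat.card_eq_fintype_card, Fintype.card_sigma]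
  simp only [Fintype.card_fin]
  exact Fin.sum_univ_eq_sum_range (fun i => i + 1) (m + 1)

/-- The two-dimensional form `2 k (k + 1)` of Möller's bound. -/
lemma dimPi_add {k : ℕ} (hk : 1 ≤ k) : dimPi (2 * k - 1) + k = 2 * (k * (k + 1)) := by
  obtain ⟨k, rfl⟩ : ∃ k', k = k' + 1 := ⟨k - 1, by omega⟩
  rw [dimPi_eq_sum]
  clear hk
  induction k with
  | zero => rfl
  | succ k ih =>
    have h1 : 2 * (k + 1 + 1) - 1 + 1 = 2 * (k + 1) - 1 + 1 + 1 + 1 := by omega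
    have h2 : 2 * (k + 1) - 1 = 2 * k + 1 := by omega
    rw [h1, Finset.sum_range_succ, Finset.sum_range_succ]
    rw [h2] at ih ⊢
    linarith

lemma Rule.numNodes_add_le (P Q : Rule) : (P + Q).numNodes ≤ P.numNodes + Q.numNodes := by
  classical
  exact (Finset.card_le_card Finsupp.support_add).trans (Finset.card_union_le _ _)

lemma Rule.numNodes_smul_le (a : ℝ) (Q : Rule) : Rule.numNodes (a • Q) ≤ Q.numNodes :=
  Finset.card_le_card Finsupp.support_smul

lemma Rule.numNodes_sum_le {ι : Type*} (s : Finset ι) (Q : ι → Rule) :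
    Rule.numNodes (∑ i ∈ s, Q i) ≤ ∑ i ∈ s, (Q i).numNodes := by
  classical
  induction s using Finset.induction_on with
  | empty => simp [Rule.numNodes]
  | insert a s ha ih =>
    rw [Finset.sum_insert ha, Finset.sum_insert ha]
    exact (Rule.numNodes_add_le _ _).trans (Nat.add_le_add_left ih _)

lemma numNodes_fourPoints_le (s t : ℝ) : (fourPoints s t).numNodes ≤ 4 := by
  have h : ∀ z : ℝ × ℝ, Rule.numNodes (Finsupp.single z 1) ≤ 1 := fun z =>
    (Finset.card_le_card Finsupp.support_single_subset).trans_eq (Finset.card_singleton z)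
  rw [fourPoints]
  refine (Rule.numNodes_add_le _ _).trans (Nat.add_le_add ((Rule.numNodes_add_le _ _).trans
    (Nat.add_le_add ((Rule.numNodes_add_le _ _).trans (Nat.add_le_add (h _) (h _))) (h _))) (h _))

lemma numNodes_sum_fourPoints_le {n : ℕ} (θ : Fin n → ℝ) (T : Fin n → Finset (Fin n))
    (a : Fin n → Fin n → ℝ) :
    Rule.numNodes (∑ k, ∑ j ∈ T k, a j k • fourPoints (sNode θ j k) (tNode θ j k)) ≤
      ∑ k, 4 * (T k).card := by
  refine (Rule.numNodes_sum_le _ _).trans (Finset.sum_le_sum fun k _ =>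
    (Rule.numNodes_sum_le _ _).trans ?_)
  rw [mul_comm]
  exact Finset.sum_le_card_nsmul _ _ _ fun j _ =>
    (Rule.numNodes_smul_le _ _).trans (numNodes_fourPoints_le _ _)

lemma numNodes_ruleMinus_le (w : ℝ → ℝ) {n : ℕ} (θ : Fin n → ℝ) :
    (ruleMinus w θ).numNodes ≤ 2 * (n * (n + 1)) := by
  refine (Rule.numNodes_smul_le _ _).trans ((numNodes_sum_fourPoints_le θ Finset.Iic fun j k =>
    (if j = k then (1 / 2 : ℝ) else 1) * (gaussWeight w θ k * gaussWeight w θ j)).trans_eq ?_)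
  simp only [Fin.card_Iic]
  rw [Fin.sum_univ_eq_sum_range fun k => 4 * (k + 1)]
  induction n with
  | zero => rfl
  | succ n ih => rw [Finset.sum_range_succ, ih fun _ => 0]; ring

lemma numNodes_rulePlus_le (w : ℝ → ℝ) {n : ℕ} (θ : Fin (n + 1) → ℝ) :
    (rulePlus w θ).numNodes ≤ 2 * (n * (n + 1)) := by
  refine (Rule.numNodes_smul_le _ _).trans ((Rule.numNodes_smul_le _ _).trans
    ((numNodes_sum_fourPoints_le θ Finset.Iio (lambdaPair w θ)).trans_eq ?_))
  simp only [Fin.card_Iio]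
  rw [Fin.sum_univ_eq_sum_range fun k => 4 * k]
  induction n with
  | zero => rfl
  | succ n ih => rw [Finset.sum_range_succ, ih fun _ => 0]; ring

/-- An unfolded product rule with at most as many nodes as Möller's bound allows is minimal, and
attains the bound. -/
lemma isMinimalRule_of_isUnfoldedProductRule {w : ℝ → ℝ}
    (hw_nonneg : ∀ t ∈ Icc (-1 : ℝ) 1, 0 ≤ w t)
    (hw_int : IntegrableOn w (Icc (-1 : ℝ) 1)) (hw_pos : 0 < ∫ t in Icc (-1 : ℝ) 1, w t)
    {n : ℕ} {θ : Fin n → ℝ} (hθ : IsZeroAngles w n θ) {e : ℕ} (he : e ≤ 1) {k : ℕ} (hk : 1 ≤ k)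
    (hkn : k + e = n) {Q : Rule} (hQ : IsUnfoldedProductRule w θ e Q)
    (hcard : Q.numNodes ≤ 2 * (k * (k + 1))) :
    IsMinimalRule square (weightCW w (e - 1 / 2)) (4 * k - 1) Q ∧
      Q.numNodes = dimPi (2 * k - 1) + k := by
  have hdeg := hasDegree_of_isUnfoldedProductRule hw_nonneg hw_int hw_pos (by omega) hθ he hQ
    (m := 4 * k - 1) (by omega)
  have hbound : ∀ Q', IsExact square (weightCW w (e - 1 / 2)) (4 * k - 1) Q' →
      2 * (k * (k + 1)) ≤ Q'.numNodes := fun Q' =>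
    two_mul_le_numNodes_of_isExact hw_nonneg hw_int hw_pos he hk
  refine ⟨⟨hdeg, fun Q' hQ' => hcard.trans (hbound Q' hQ')⟩, ?_⟩
  rw [dimPi_add hk]
  exact le_antisymm hcard (hbound Q hdeg.1)

end MinimalCubature
end

theorem mainTheorem1 (w : ℝ → ℝ) (hw_nonneg : ∀ t ∈ Set.Icc (-1 : ℝ) 1, 0 ≤ w t)
    (hw_int : MeasureTheory.IntegrableOn w (Set.Icc (-1 : ℝ) 1))
    (hw_pos : 0 < ∫ t in Set.Icc (-1 : ℝ) 1, w t) (n : ℕ) (hn : 1 ≤ n) :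
    (∃ θ : Fin n → ℝ, MinimalCubature.IsZeroAngles w n θ) ∧
    ∀ θ : Fin n → ℝ, MinimalCubature.IsZeroAngles w n θ →
      -- the `λ_k` are the weights of the Gauss quadrature rule for `w`
      (∀ f : Polynomial ℝ, f.natDegree ≤ 2 * n - 1 →
        MinimalCubature.cNorm w * ∫ t in Set.Icc (-1 : ℝ) 1, f.eval t * w t =
          ∑ k, MinimalCubature.gaussWeight w θ k * f.eval (Real.cos (θ k))) ∧
      -- the minimal rule of degree `4n - 1` for the exponent `-1/2`
      (MinimalCubature.IsMinimalRule MinimalCubature.square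
          (MinimalCubature.weightCW w (-1 / 2)) (4 * n - 1) (MinimalCubature.ruleMinus w θ) ∧
        (MinimalCubature.ruleMinus w θ).numNodes = MinimalCubature.dimPi (2 * n - 1) + n) ∧
      -- the minimal rule of degree `4n - 5` for the exponent `1/2`
      (2 ≤ n →
        MinimalCubature.IsMinimalRule MinimalCubature.square
          (MinimalCubature.weightCW w (1 / 2)) (4 * n - 5) (MinimalCubature.rulePlus w θ) ∧
        (MinimalCubature.rulePlus w θ).numNodes =
          MinimalCubature.dimPi (2 * n - 3) + (n - 1)) := by
  refine ⟨MinimalCubature.exists_isZeroAngles hw_nonneg hw_int hw_pos n, fun θ hθ =>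
    ⟨MinimalCubature.gauss_quadrature hw_nonneg hw_int hw_pos hn hθ, ?_, fun hn2 => ?_⟩⟩
  · have h := MinimalCubature.isMinimalRule_of_isUnfoldedProductRule hw_nonneg hw_int hw_pos hθ
      zero_le_one hn (add_zero n)
      (MinimalCubature.isUnfoldedProductRule_ruleMinus hw_int hw_pos θ)
      (MinimalCubature.numNodes_ruleMinus_le w θ)
    have he : ((0 : ℕ) : ℝ) - 1 / 2 = -1 / 2 := by norm_num
    rwa [he] at h
  · obtain ⟨k, rfl⟩ : ∃ k, n = k + 1 := ⟨n - 1, by omega⟩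
    have h := MinimalCubature.isMinimalRule_of_isUnfoldedProductRule hw_nonneg hw_int hw_pos hθ
      le_rfl (by omega : 1 ≤ k) rfl
      (MinimalCubature.isUnfoldedProductRule_rulePlus w θ)
      (MinimalCubature.numNodes_rulePlus_le w θ)
    have he : ((1 : ℕ) : ℝ) - 1 / 2 = 1 / 2 := by norm_num
    have h1 : 4 * (k + 1) - 5 = 4 * k - 1 := by omega
    have h2 : 2 * (k + 1) - 3 = 2 * k - 1 := by omega
    rw [he] at h
    rw [h1, h2, Nat.add_sub_cancel]
    exact h
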